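/- Let $K$ be an algebraically closed field, $Q$ a finite quiver, $L\ge 0$, and $\Lambda = KQ/\langle\text{all paths of length } L+1\rangle$ with Jacobson radical $J$ and vertex idempotents $e_1,\dots,e_n$; products of paths are read from right to left. Let $\mathbb S=(\mathbb S_0,\dots,\mathbb S_L)$ be a sequence of finite dimensional semisimple left $\Lambda$-modules (identified with their dimension vectors) which is realizable, i.e., $\mathbb S=\mathbb S(M):=(J^lM/J^{l+1}M)_{0\le l\le L}$ for some finite dimensional $\Lambda$-module $M$. Put $\mathbf d=\sum_l\underline{\dim}\,\mathbb S_l$, and let $\operatorname{Rep}\mathbb S$ be the set of those points of the affine variety $\operatorname{Rep}_{\mathbf d}(\Lambda)$ (Zariski topology) whose corresponding modules have radical layering $\mathbb S$. A property holds generically on $\overline{\operatorname{Rep}\mathbb S}$ if it holds on a dense open subset of it. Let $P=\bigoplus_r\Lambda z_r$, with $\Lambda z_r\cong\Lambda e(r)$, be a projective cover of $\mathbb S_0$. A path in $P$ is an element $pz_r$, with $p$ a path of $Q$ of length at most $L$ starting in $e(r)$; its initial subpaths are the $p'z_r$ with $p=p''p'$. A skeleton with layering $\mathbb S$ is a set $\sigma$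 of paths in $P$ that is closed under initial subpaths and contains, for all $l$ and $i$, exactly as many paths of length $l$ ending in $e_i$ as the multiplicity of $S_i=\Lambda e_i/Je_i$ in $\mathbb S_l$. A path $\mathbf q$ in $P$ is $\sigma$-critical if $\mathbf q\notin\sigma$ while all its proper initial subpaths are in $\sigma$; then $\sigma(\mathbf q)$ is the set of those paths in $\sigma$ which end in the same vertex as $\mathbf q$ and are at least as long as $\mathbf q$. For a family $x=(x_{\mathbf q,\mathbf p})$ of scalars ($\mathbf q$ $\sigma$-critical, $\mathbf p\in\sigma(\mathbf q)$), let $R(\sigma)_x\subseteq P$ be the submodule generated by the elements $\mathbf q-\sum_{\mathbf p\in\sigma(\mathbf q)}x_{\mathbf q,\mathbf p}\,\mathbf p$. Define polynomials $c(p,u,v)\in\mathbb Z[x_{\mathbf q,\mathbf p}]$, for $p$ a path of $Q$ and $u,v\in\sigma$, by the expansions $p\,u=\sum_{v\in\sigma}c(p,u,v)\,v$ which result from the following rules: a vertex $e_i$ fixes $u$ if $u$ ends in $e_i$ and annihilates it otherwise; for an arrow $\alpha$ and $u\in\sigma$ the product $\alpha u$ is $0$ if $\alpha$ does not start where $u$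 ends or if the path $\alpha u$ is longer than $L$, it is the path $\alpha u$ if this belongs to $\sigma$, and otherwise (then $\alpha u$ is $\sigma$-critical) it is $\sum_{\mathbf p\in\sigma(\alpha u)}x_{\alpha u,\mathbf p}\,\mathbf p$. Consider the homogeneous system of linear equations, with coefficients in $\mathbb Z[x_{\mathbf q,\mathbf p}]$ depending only on $Q$, $\mathbb S$ and $\sigma$, in the unknowns $k_{j,u}$ ($u\in\sigma$ ending in $e(j)$), obtained by comparing the coefficients of all $v\in\sigma$ in $$\sum_u k_{s,u}\,q\,u=\sum_{pz_r\in\sigma(qz_s)}x_{qz_s,pz_r}\sum_u k_{r,u}\,p\,u\qquad\text{for all $\sigma$-critical paths } qz_s.$$ Then $\overline{\operatorname{Rep}\mathbb S}$ is irreducible, skeleta with layering $\mathbb S$ exist, and for every such skeleton $\sigma$: 1. Generically on $\overline{\operatorname{Rep}\mathbb S}$, $\dim_K\operatorname{End}_\Lambda(M)$ equals the dimension of the solution space of the system over the rational function field $K_0(x_{\mathbf q,\mathbf p})$ in independent variables, $K_0$ being the prime field of $K$. 2. For every family $x$ of scalars in $K$, the classes of the elements of $\sigma$ form a $K$-basis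 of $P/R(\sigma)_x$ on which the paths of $Q$ act by the coefficients $c(p,u,v)(x)$, and there is a $K$-linear isomorphism from $\operatorname{End}_\Lambda(P/R(\sigma)_x)$ onto the solution space over $K$ of the system at $x$, which sends $\phi$ to the scalars $k_{j,u}$ with $\phi(z_j)=\sum_u k_{j,u}\,u$. 3. If the family $x$ in $K$ is algebraically independent over $K_0$, then the solution space at $x$ and $\operatorname{End}_\Lambda(P/R(\sigma)_x)$ have the generic dimension given in 1. -/

import Mathlib

universe u v w

noncomputable section

namespace TruncPath

/-! ### Truncated path algebras -/

/-- Generators of the path algebra `KQ`: the vertices (lazy paths) and the arrows of `Q`. -/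
inductive Gen (V : Type v) [Quiver.{w} V] : Type (max v w)
  | vertex (i : V) : Gen V
  | arrow {i j : V} (a : i ⟶ j) : Gen V

section Algebra

variable (K : Type u) [Field K] {V : Type v} [Quiver.{w} V]

/-- The path `p` as a monomial in the free algebra. Products of paths are read from right to left,
so appending an arrow at the end of `p` is multiplication by that arrow from the left. -/
def freePath {i : V} : {j : V} → Quiver.Path i j → FreeAlgebra K (Gen V)
  | _, .nil => FreeAlgebra.ι K (Gen.vertex i)
  | _, .cons p a => FreeAlgebra.ι K (Gen.arrow a) * freePath p

open Classical in
/-- Defining relations of `KQ / ⟨all paths of length L + 1⟩`: the vertices are orthogonal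
idempotents with sum `1`, an arrow `a : i ⟶ j` satisfies `e_j a = a = a e_i`, and the paths of
length `L + 1` vanish. -/
inductive Rel [Fintype V] (L : ℕ) : FreeAlgebra K (Gen V) → FreeAlgebra K (Gen V) → Prop
  | orth (i j : V) :
      Rel L (FreeAlgebra.ι K (Gen.vertex i) * FreeAlgebra.ι K (Gen.vertex j))
        (if i = j then FreeAlgebra.ι K (Gen.vertex i) else 0)
  | sum_one : Rel L (∑ i : V, FreeAlgebra.ι K (Gen.vertex i)) 1
  | target_mul {i j : V} (a : i ⟶ j) :
      Rel L (FreeAlgebra.ι K (Gen.vertex j) * FreeAlgebra.ι K (Gen.arrow a))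
        (FreeAlgebra.ι K (Gen.arrow a))
  | mul_source {i j : V} (a : i ⟶ j) :
      Rel L (FreeAlgebra.ι K (Gen.arrow a) * FreeAlgebra.ι K (Gen.vertex i))
        (FreeAlgebra.ι K (Gen.arrow a))
  | trunc {i j : V} (p : Quiver.Path i j) (hp : p.length = L + 1) : Rel L (freePath K p) 0

variable (V) in
/-- The truncated path algebra `Λ = KQ / ⟨all paths of length L + 1⟩`. -/
def Lam [Fintype V] (L : ℕ) : Type (max u v w) := RingQuot (Rel K (V := V) L)

variable [Fintype V] (L : ℕ)

instance : Ring (Lam K V L) := inferInstanceAs (Ring (RingQuot (Rel K (V := V) L)))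

instance : Algebra K (Lam K V L) := inferInstanceAs (Algebra K (RingQuot (Rel K (V := V) L)))

/-- The quotient map from the free algebra to `Λ`. -/
def Lam.mk : FreeAlgebra K (Gen V) →ₐ[K] Lam K V L := RingQuot.mkAlgHom K (Rel K (V := V) L)

/-- The primitive idempotent `e_i`. -/
def idem (i : V) : Lam K V L := Lam.mk K L (FreeAlgebra.ι K (Gen.vertex i))

/-- The class in `Λ` of a path of `Q`. -/
def pathElt {i j : V} (p : Quiver.Path i j) : Lam K V L := Lam.mk K L (freePath K p)

/-! ### Radical layerings and semisimple sequences

A semisimple sequence `(𝕊_0, …, 𝕊_L)` is given by the multiplicities `S l i` of the simple modules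
`S_i = Λ e_i / J e_i` in `𝕊_l`. -/

/-- `J ^ l M`, with `J` the Jacobson radical of `Λ`. -/
def radPow (M : Type*) [AddCommGroup M] [Module (Lam K V L) M] (l : ℕ) :
    Submodule (Lam K V L) M :=
  (Ring.jacobson (Lam K V L)) ^ l • (⊤ : Submodule (Lam K V L) M)

/-- The radical layer `J ^ l M / J ^ (l + 1) M`. -/
abbrev RadLayer (M : Type*) [AddCommGroup M] [Module (Lam K V L) M] (l : ℕ) : Type _ :=
  (radPow K (V := V) L M l) ⧸
    ((radPow K (V := V) L M (l + 1)).submoduleOf (radPow K (V := V) L M l))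

/-- The multiplicity of `S_i` in `J ^ l M / J ^ (l + 1) M`, which is the dimension over `K` of
`e_i (J ^ l M / J ^ (l + 1) M)`. -/
def radMult (M : Type*) [AddCommGroup M] [Module K M] [Module (Lam K V L) M]
    [IsScalarTower K (Lam K V L) M] (l : ℕ) (i : V) : ℕ :=
  Module.finrank K (LinearMap.range (Algebra.lsmul K K (RadLayer K (V := V) L M l) (idem K L i)))

variable {L} (S : Fin (L + 1) → V → ℕ)

/-- `M` has radical layering `S`. -/
def HasLayering (M : Type*) [AddCommGroup M] [Module K M] [Module (Lam K V L) M]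
    [IsScalarTower K (Lam K V L) M] : Prop :=
  ∀ (l : Fin (L + 1)) (i : V), radMult K L M l i = S l i

/-- `S` is the radical layering of some finite dimensional left `Λ`-module. -/
def Realizable : Prop :=
  ∃ (M : Type u) (_ : AddCommGroup M) (_ : Module K M) (_ : Module (Lam K V L) M)
    (_ : IsScalarTower K (Lam K V L) M), Module.Finite K M ∧ HasLayering K S M

/-- The dimension vector of a semisimple sequence. -/
def dimVec {V : Type v} {L : ℕ} (S : Fin (L + 1) → V → ℕ) (i : V) : ℕ := ∑ l, S l i

end Algebra

/-! ### The varieties `Rep_d(Λ)` and `Rep 𝕊` -/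

section Variety

/-- The Zariski topology on the affine space `K ^ ι`: the non-vanishing sets of polynomials form
a basis of open sets. -/
abbrev zariski (ι : Type*) (K : Type*) [CommSemiring K] : TopologicalSpace (ι → K) :=
  TopologicalSpace.generateFrom
    {U | ∃ f : MvPolynomial ι K, U = {x | MvPolynomial.eval x f ≠ 0}}

variable (K : Type u) [Field K] {V : Type v} [Quiver.{w} V]

/-- Index set of the entries of a family `(x_a)` of `d_j × d_i` matrices, one for each arrow
`a : i ⟶ j`. -/
abbrev Coord (d : V → ℕ) : Type (max v w) :=
  Σ (i : V) (j : V) (_ : i ⟶ j), Fin (d j) × Fin (d i)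

variable {K} {d : V → ℕ}

/-- The matrix of the arrow `a`. -/
def arrowMat (x : Coord d → K) {i j : V} (a : i ⟶ j) : Matrix (Fin (d j)) (Fin (d i)) K :=
  Matrix.of fun r c => x ⟨i, j, a, r, c⟩

/-- The matrix of a path. -/
def pathMat (x : Coord d → K) {i : V} : {j : V} → Quiver.Path i j →
    Matrix (Fin (d j)) (Fin (d i)) K
  | _, .nil => 1
  | _, .cons p a => arrowMat x a * pathMat x p

variable (K) in
/-- `Rep_d(Λ)`: the families of matrices for which all paths of length `L + 1` act as zero. -/
def RepVar (L : ℕ) (d : V → ℕ) : Type (max u v w) :=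
  {x : Coord d → K // ∀ (i j : V) (p : Quiver.Path i j), p.length = L + 1 → pathMat x p = 0}

instance (L : ℕ) (d : V → ℕ) : TopologicalSpace (RepVar K L d) :=
  (zariski (Coord d) K).induced Subtype.val

open Classical in
/-- The operators on `⨁ i, K ^ (d i)` by which vertices and arrows act. -/
def genAct (x : Coord d → K) : Gen V → Module.End K ((i : V) → Fin (d i) → K)
  | .vertex i => LinearMap.single K (fun i => Fin (d i) → K) i ∘ₗ LinearMap.proj i
  | .arrow (i := i) (j := j) a =>
      LinearMap.single K (fun i => Fin (d i) → K) j ∘ₗ Matrix.mulVecLin (arrowMat x a) ∘ₗ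
        LinearMap.proj i

open Classical in
theorem lift_freePath (x : Coord d → K) {i j : V} (p : Quiver.Path i j) :
    FreeAlgebra.lift K (genAct x) (freePath K p) =
      LinearMap.single K (fun i => Fin (d i) → K) j ∘ₗ Matrix.mulVecLin (pathMat x p) ∘ₗ
        LinearMap.proj i := by
  induction p with
  | nil => simp [freePath, pathMat, genAct]
  | cons p a ih =>
    rw [freePath, map_mul, ih, FreeAlgebra.lift_ι_apply, pathMat, Matrix.mulVecLin_mul]
    refine LinearMap.ext fun m => ?_
    simp [genAct]

variable [Fintype V] {L : ℕ}

theorem lift_rel (x : RepVar K L d) ⦃s t : FreeAlgebra K (Gen V)⦄ (h : Rel K L s t) :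
    FreeAlgebra.lift K (genAct x.1) s = FreeAlgebra.lift K (genAct x.1) t := by
  classical
  induction h with
  | orth i j =>
    by_cases hij : i = j
    · subst hij
      refine LinearMap.ext fun m => ?_
      simp [genAct]
    · refine LinearMap.ext fun m => ?_
      simp [genAct, hij]
  | sum_one =>
    refine LinearMap.ext fun m => ?_
    simp only [map_sum, FreeAlgebra.lift_ι_apply, map_one, LinearMap.sum_apply,
      Module.End.one_apply]
    funext i
    simp [genAct, Finset.sum_apply]
  | target_mul a =>
    refine LinearMap.ext fun m => ?_
    simp [genAct]
  | mul_source a =>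
    refine LinearMap.ext fun m => ?_
    simp [genAct]
  | trunc p hp =>
    rw [lift_freePath, x.2 _ _ p hp]
    simp

/-- The algebra map `Λ → End_K(⨁ i, K ^ (d i))` given by a point of `Rep_d(Λ)`. -/
def action (x : RepVar K L d) : Lam K V L →ₐ[K] Module.End K ((i : V) → Fin (d i) → K) :=
  RingQuot.liftAlgHom K ⟨FreeAlgebra.lift K (genAct x.1), lift_rel x⟩

/-- The `Λ`-module `M_x = ⨁ i, K ^ (d i)` corresponding to a point `x` of `Rep_d(Λ)`. -/
def RepModule (_ : RepVar K L d) : Type (max u v) := (i : V) → Fin (d i) → K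

instance (x : RepVar K L d) : AddCommGroup (RepModule x) :=
  inferInstanceAs (AddCommGroup ((i : V) → Fin (d i) → K))

instance (x : RepVar K L d) : Module K (RepModule x) :=
  inferInstanceAs (Module K ((i : V) → Fin (d i) → K))

instance (x : RepVar K L d) : Module (Lam K V L) (RepModule x) :=
  Module.compHom ((i : V) → Fin (d i) → K) (action x).toRingHom

instance (x : RepVar K L d) : IsScalarTower K (Lam K V L) (RepModule x) :=
  ⟨fun c a m => congrArg (fun f : Module.End K ((i : V) → Fin (d i) → K) => f m)
    ((action x).map_smul_of_tower c a)⟩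

variable (K) in
/-- `Rep 𝕊`: the points of `Rep_d(Λ)`, `d = dim 𝕊`, whose modules have radical layering `𝕊`. -/
def RepS (S : Fin (L + 1) → V → ℕ) : Set (RepVar K L (dimVec S)) :=
  {x | HasLayering K S (RepModule x)}

/-- The points of `U` generically have property `P`: all points of some dense (relatively) open
subset of `U` have property `P`. -/
def Generically {X : Type*} [TopologicalSpace X] (U : Set X) (P : X → Prop) : Prop :=
  ∃ O : Set X, IsOpen O ∧ U ⊆ closure (O ∩ U) ∧ ∀ x ∈ O ∩ U, P x

end Variety

/-! ### Skeleta -/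

section Skeleton

variable {V : Type v} [Quiver.{w} V] {L : ℕ} (S : Fin (L + 1) → V → ℕ)

/-- Index set of the top elements `z_r` of the projective cover of `𝕊_0`: for each vertex `i`
there are `S 0 i` of them with `e(r) = i`, and `e(r)` is the first component of `r`. -/
abbrev Top : Type v := Σ i : V, Fin (S 0 i)

/-- A path `p z_r`, where `p` is a path of `Q` starting at `e(r)`. -/
structure PPath : Type (max v w) where
  /-- the index `r` of the top element `z_r` -/
  root : Top S
  /-- the vertex where the path ends -/
  target : V
  /-- the path `p` -/
  path : Quiver.Path root.1 target

variable {S}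

open Classical in
/-- `σ` is an abstract skeleton with layering `S`: a set of paths of length at most `L`, closed
under initial subpaths, such that exactly `S l i` of its paths of length `l` end in `i`. -/
structure IsSkeleton (σ : Finset (PPath S)) : Prop where
  length_le : ∀ u ∈ σ, u.path.length ≤ L
  initial_mem : ∀ (r : Top S) (i j : V) (p : Quiver.Path r.1 i) (q : Quiver.Path i j),
    (⟨r, j, p.comp q⟩ : PPath S) ∈ σ → (⟨r, i, p⟩ : PPath S) ∈ σ
  card_layer : ∀ (l : Fin (L + 1)) (i : V),
    (σ.filter fun u => u.path.length = (l : ℕ) ∧ u.target = i).card = S l i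

variable (σ : Finset (PPath S))

/-- `q` is a `σ`-critical path: it is a path of length at most `L` not in `σ`, all of whose proper
initial subpaths are in `σ`. -/
def IsCritical (q : PPath S) : Prop :=
  q.path.length ≤ L ∧ q ∉ σ ∧
    ∀ (i : V) (p : Quiver.Path q.root.1 i) (p' : Quiver.Path i q.target),
      q.path = p.comp p' → 0 < p'.length → (⟨q.root, i, p⟩ : PPath S) ∈ σ

/-- The type of `σ`-critical paths. -/
abbrev Crit : Type (max v w) := {q : PPath S // IsCritical σ q}

/-- `p ∈ σ(q)`: the path `p` of `σ` ends where `q` ends and is at least as long as `q`. -/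
def InSigma (q p : PPath S) : Prop :=
  p ∈ σ ∧ p.target = q.target ∧ q.path.length ≤ p.path.length

/-- Index set of the parameters `x_{q,p}`, where `q` is `σ`-critical and `p ∈ σ(q)`. -/
abbrev Param : Type (max v w) := {qp : PPath S × PPath S // IsCritical σ qp.1 ∧ InSigma σ qp.1 qp.2}

variable {σ}

open Classical in
/-- The scalar `x_{q,p}` if `q` is `σ`-critical and `p ∈ σ(q)`, and `0` otherwise. -/
def par {R : Type*} [CommRing R] (x : Param σ → R) (q p : PPath S) : R :=
  if h : IsCritical σ q ∧ InSigma σ q p then x ⟨(q, p), h⟩ else 0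

/-! ### The system of linear equations -/

open Classical in
/-- Coefficient at `v` of the expansion of `a u` along `σ`, for an arrow `a` and `u ∈ σ`.
It is zero unless `u` ends where `a` starts. In that case either `a u` is in `σ`, or it is
`σ`-critical and equal to `∑ v ∈ σ(a u), x_{a u, v} v`, or it is longer than `L` and hence zero. -/
def arrowCoeff {i j : V} (a : i ⟶ j)
    (u v : {u : PPath S // u ∈ σ}) : MvPolynomial (Param σ) ℤ :=
  if h : u.1.target = i then
    let au : PPath S := ⟨u.1.root, j, (u.1.path.cast rfl h).cons a⟩
    if au ∈ σ then (if v.1 = au then 1 else 0) else par MvPolynomial.X au v.1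
  else 0

variable (σ) in
open Classical in
/-- The coefficient `c(p, u, v)` in `p u = ∑ v ∈ σ, c(p, u, v) v`, for a path `p` of `Q` and
`u ∈ σ`, as a polynomial with integer coefficients in the parameters `x_{q,p}`. -/
def pathCoeff {i : V} : {j : V} → Quiver.Path i j →
    {u : PPath S // u ∈ σ} → {u : PPath S // u ∈ σ} → MvPolynomial (Param σ) ℤ
  | _, .nil, u, v => if u.1.target = i ∧ u = v then 1 else 0
  | _, .cons p a, u, v => ∑ t, pathCoeff p u t * arrowCoeff a t v

variable (σ) in
/-- Index set of the unknowns `k_{j,u}`: here `u ∈ σ` ends in the vertex `e(j)`. -/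
abbrev Unknown : Type (max v w) :=
  {ju : Top S × {u : PPath S // u ∈ σ} // ju.2.1.target = ju.1.1}

variable (σ) in
open Classical in
/-- Coefficient matrix of the system. The equation with index `(q, v)` compares the coefficients
of `v ∈ σ` on the two sides of `q φ(z_s) = ∑ p z_r ∈ σ(q z_s), x_{q z_s, p z_r} p φ(z_r)`, where
`φ(z_j) = ∑ u, k_{j,u} u`. -/
def system : Matrix (Crit σ × {u : PPath S // u ∈ σ}) (Unknown σ) (MvPolynomial (Param σ) ℤ) :=
  Matrix.of fun qv ju =>
    (if qv.1.1.root = ju.1.1 then pathCoeff σ qv.1.1.path ju.1.2 qv.2 else 0) -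
      ∑ p : {u : PPath S // u ∈ σ},
        if p.1.root = ju.1.1 then
          par MvPolynomial.X qv.1.1 p.1 * pathCoeff σ p.1.path ju.1.2 qv.2
        else 0

open Classical in
/-- The scalar `k_{j,u}` if `u` ends in `e(j)`, and `0` otherwise. -/
def coef {F : Type*} [Field F] (k : Unknown σ → F) (j : Top S) (u : {u : PPath S // u ∈ σ}) : F :=
  if h : u.1.target = j.1 then k ⟨(j, u), h⟩ else 0

variable [Fintype V]

open Classical in
/-- The solution space over a field `F` of the system, for given values `x_{q,p}` in `F`. -/
def solutions {F : Type*} [Field F] (x : Param σ → F) : Submodule F (Unknown σ → F) :=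
  LinearMap.ker (Matrix.mulVecLin ((system σ).map (MvPolynomial.aeval x)))

variable (σ) in
/-- The dimension of the solution space of the system over the field `K₀(x_{q,p})` of rational
functions in independent variables `x_{q,p}`, where `K₀` is the prime field of `K`. -/
def genericSolutionDim (K : Type u) [Field K] : ℕ :=
  Module.finrank (FractionRing (MvPolynomial (Param σ) (⊥ : Subfield K)))
    (solutions fun i : Param σ =>
      algebraMap (MvPolynomial (Param σ) (⊥ : Subfield K))
        (FractionRing (MvPolynomial (Param σ) (⊥ : Subfield K))) (MvPolynomial.X i))

/-! ### The projective presentations `P / R(σ)` -/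

variable (K : Type u) [Field K]

variable (S) in
/-- The distinguished projective cover `P = ⨁ r, Λ z_r` of `𝕊_0`, with `Λ z_r = Λ e(r)`. -/
abbrev ProjCover : Type (max u v w) :=
  (r : Top S) → (Submodule.span (Lam K V L) {idem K L r.1} : Submodule (Lam K V L) (Lam K V L))

open Classical in
/-- The top element `z_r` of `P`. -/
def topElt (r : Top S) : ProjCover S K :=
  Pi.single r ⟨idem K L r.1, Submodule.mem_span_singleton_self _⟩

/-- The element `p z_r` of `P`. -/
def PPath.elt (u : PPath S) : ProjCover S K := pathElt K L u.path • topElt K u.root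

variable {K}

/-- The submodule `R(σ)` of `P` generated by the elements `q - ∑ p ∈ σ(q), x_{q,p} p` for
`σ`-critical `q`. -/
def relSub (x : Param σ → K) : Submodule (Lam K V L) (ProjCover S K) :=
  Submodule.span (Lam K V L)
    (Set.range fun q : Crit σ => q.1.elt K - ∑ p ∈ σ, par x q.1 p • p.elt K)

/-- The module `P / R(σ)`. -/
abbrev Pres (x : Param σ → K) : Type (max u v w) := ProjCover S K ⧸ relSub x

/-- The class of `p z_r` in `P / R(σ)`. -/
def cls (x : Param σ → K) (u : PPath S) : Pres x := (relSub x).mkQ (u.elt K)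

/-- The class of `z_r` in `P / R(σ)`. -/
def topCls (x : Param σ → K) (r : Top S) : Pres x := (relSub x).mkQ (topElt K r)

end Skeleton

end TruncPath

end

/-! Path length does most of the work. An arrow sends a path of `σ` to a combination of strictly
longer paths of `σ` (`arrowCoeff_ne_zero`), so for every family `x` the prescribed arrow matrices on
`K^σ` kill all paths of length `L + 1`: no consistency conditions on `x` arise. This representation
satisfies the relations defining `P / R(σ)_x`, and comparison with it shows that `σ` gives a basis
(`span_cls`, `linearIndependent_cls`). An endomorphism of `P / R(σ)_x` is a choice of images of the
`z_j` in the right vertex spaces that again satisfy the relations; in coordinates along `σ` this is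
the linear system (`range_endScalars`).

The minors of the system are integer polynomials in the parameters. A minor that does not vanish at
a point is nonzero over the prime field, so the rank over the rational function field is maximal. It
is attained at some point over the infinite field `K`, and at every algebraically independent point.
Hence the generic solution dimension is the minimum of `dim End (P / R(σ)_x)` over all `x`.

Three geometric facts carry this minimum over to `Rep 𝕊`. First, `Rep 𝕊` is irreducible: in a basis
adapted to the radical filtration all arrows strictly raise the level, so `Rep 𝕊` is the image of an
open subset of an affine space under a polynomial map `(g, y) ↦ g y adj(g)` (`exists_conjPoint_eq`,
`isOpen_conj`). Second, `dim End` is upper semicontinuous, being the corank of a matrix with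
polynomial entries (`isOpen_finrank_end_le`). Third, all modules in some relatively open
neighbourhood of a given `P / R(σ)_x` in `Rep 𝕊` have the form `P / R(σ)_x'`
(`exists_isOpen_presEquiv`). A point of `Rep 𝕊` with smaller `dim End` would, by irreducibility,
force one in that neighbourhood, against minimality. So the minimum is attained exactly on a dense
open subset.

Skeleta exist because the layers of a module grow at most as fast as the arrows allow
(`HasLayering.le_sum`), which leaves enough one-arrow extensions to choose a skeleton layer by
layer. -/

noncomputable section

namespace TruncPath

/-! ### The radical of a truncated path algebra -/

section Radical

variable {K : Type u} [Field K] {V : Type v} [Quiver.{w} V] [Fintype V] {L : ℕ}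

variable (K L) in
/-- The class in `Λ` of an arrow of `Q`. -/
def arrowElt {i j : V} (a : i ⟶ j) : Lam K V L := Lam.mk K L (FreeAlgebra.ι K (Gen.arrow a))

theorem Lam.mk_eq {s t : FreeAlgebra K (Gen V)} (h : Rel K L s t) : Lam.mk K L s = Lam.mk K L t :=
  RingQuot.mkAlgHom_rel K h

theorem Lam.mk_surjective : Function.Surjective (Lam.mk K (V := V) L) :=
  RingQuot.mkAlgHom_surjective K _

theorem idem_mul_self (i : V) : idem K L i * idem K L i = idem K L i := by
  have := Lam.mk_eq (Rel.orth (K := K) (L := L) i i)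
  rwa [if_pos rfl, map_mul] at this

theorem idem_mul_ne {i j : V} (h : i ≠ j) : idem K L i * idem K L j = 0 := by
  have := Lam.mk_eq (Rel.orth (K := K) (L := L) i j)
  rwa [if_neg h, map_mul, map_zero] at this

theorem sum_idem : ∑ i : V, idem K L i = 1 := by
  have := Lam.mk_eq (Rel.sum_one (K := K) (V := V) (L := L))
  rwa [map_sum, map_one] at this

theorem idem_mul_arrowElt {i j : V} (a : i ⟶ j) :
    idem K L j * arrowElt K L a = arrowElt K L a := by
  have := Lam.mk_eq (Rel.target_mul (K := K) (L := L) a)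
  rwa [map_mul] at this

theorem arrowElt_mul_idem {i j : V} (a : i ⟶ j) :
    arrowElt K L a * idem K L i = arrowElt K L a := by
  have := Lam.mk_eq (Rel.mul_source (K := K) (L := L) a)
  rwa [map_mul] at this

theorem pathElt_nil (i : V) : pathElt K L (Quiver.Path.nil : Quiver.Path i i) = idem K L i := rfl

theorem pathElt_cons {i j k : V} (p : Quiver.Path i j) (a : j ⟶ k) :
    pathElt K L (p.cons a) = arrowElt K L a * pathElt K L p :=
  map_mul _ _ _

theorem pathElt_eq_zero {i j : V} (p : Quiver.Path i j) (h : L < p.length) :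
    pathElt K L p = 0 := by
  induction p with
  | nil => simp at h
  | cons p a ih =>
    rw [Quiver.Path.length_cons] at h
    rcases Nat.lt_or_ge L p.length with h' | h'
    · rw [pathElt_cons, ih h', mul_zero]
    · have := Lam.mk_eq (Rel.trunc (K := K) (L := L) (p.cons a)
        (by rw [Quiver.Path.length_cons]; omega))
      rwa [map_zero] at this

theorem idem_mul_pathElt {i j : V} (p : Quiver.Path i j) :
    idem K L j * pathElt K L p = pathElt K L p := by
  cases p with
  | nil => exact idem_mul_self i
  | cons p a => rw [pathElt_cons, ← mul_assoc, idem_mul_arrowElt]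

theorem idem_mul_pathElt_ne {i j k : V} (p : Quiver.Path i j) (h : k ≠ j) :
    idem K L k * pathElt K L p = 0 := by
  rw [← idem_mul_pathElt, ← mul_assoc, idem_mul_ne h, zero_mul]

theorem arrowElt_mul_pathElt_ne {i j k l : V} (p : Quiver.Path i j) (a : k ⟶ l) (h : k ≠ j) :
    arrowElt K L a * pathElt K L p = 0 := by
  rw [← arrowElt_mul_idem, mul_assoc, idem_mul_pathElt_ne p h, mul_zero]

variable (K V L) in
/-- The `K`-span of the paths of length at least `l`. -/
def pathSpan (l : ℕ) : Submodule K (Lam K V L) :=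
  Submodule.span K {x | ∃ (i j : V) (p : Quiver.Path i j), l ≤ p.length ∧ pathElt K L p = x}

theorem pathElt_mem_pathSpan {i j : V} (p : Quiver.Path i j) {l : ℕ} (h : l ≤ p.length) :
    pathElt K L p ∈ pathSpan K V L l :=
  Submodule.subset_span ⟨i, j, p, h, rfl⟩

theorem pathSpan_antitone : Antitone (pathSpan K V L) := fun _ _ h =>
  Submodule.span_mono fun _ ⟨i, j, p, hp, hx⟩ => ⟨i, j, p, h.trans hp, hx⟩

theorem idem_mul_mem_pathSpan (i : V) {l : ℕ} {x : Lam K V L} (hx : x ∈ pathSpan K V L l) :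
    idem K L i * x ∈ pathSpan K V L l := by
  induction hx using Submodule.span_induction with
  | mem x h =>
    obtain ⟨k, j, p, hp, rfl⟩ := h
    rcases eq_or_ne i j with rfl | hij
    · rw [idem_mul_pathElt]; exact pathElt_mem_pathSpan p hp
    · rw [idem_mul_pathElt_ne p hij]; exact zero_mem _
  | zero => rw [mul_zero]; exact zero_mem _
  | add x y _ _ hx hy => rw [mul_add]; exact add_mem hx hy
  | smul c x _ hx => rw [mul_smul_comm]; exact Submodule.smul_mem _ _ hx

theorem arrowElt_mul_mem_pathSpan {i j : V} (a : i ⟶ j) {l : ℕ} {x : Lam K V L}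
    (hx : x ∈ pathSpan K V L l) : arrowElt K L a * x ∈ pathSpan K V L (l + 1) := by
  induction hx using Submodule.span_induction with
  | mem x h =>
    obtain ⟨k, m, p, hp, rfl⟩ := h
    rcases eq_or_ne i m with rfl | him
    · rw [← pathElt_cons]; exact pathElt_mem_pathSpan _ (by simpa using hp)
    · rw [arrowElt_mul_pathElt_ne p a him]; exact zero_mem _
  | zero => rw [mul_zero]; exact zero_mem _
  | add x y _ _ hx hy => rw [mul_add]; exact add_mem hx hy
  | smul c x _ hx => rw [mul_smul_comm]; exact Submodule.smul_mem _ _ hx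

/-- A `K`-subspace of a `Λ`-module that is stable under vertices and arrows is stable
under `Λ`. -/
theorem smul_mem_of_stable {M : Type*} [AddCommGroup M] [Module K M] [Module (Lam K V L) M]
    [IsScalarTower K (Lam K V L) M] (W : Submodule K M)
    (hv : ∀ (i : V), ∀ m ∈ W, idem K L i • m ∈ W)
    (ha : ∀ (i j : V) (a : i ⟶ j), ∀ m ∈ W, arrowElt K L a • m ∈ W)
    (x : Lam K V L) {m : M} (hm : m ∈ W) : x • m ∈ W := by
  obtain ⟨f, rfl⟩ := Lam.mk_surjective x
  induction f using FreeAlgebra.induction generalizing m with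
  | grade0 r => rw [AlgHom.commutes, algebraMap_smul]; exact W.smul_mem _ hm
  | grade1 g =>
    cases g with
    | vertex i => exact hv i m hm
    | arrow a => exact ha _ _ a m hm
  | mul f g hf hg => rw [map_mul, mul_smul]; exact hf (hg hm)
  | add f g hf hg => rw [map_add, add_smul]; exact add_mem (hf hm) (hg hm)

theorem pathSpan_zero : pathSpan K V L 0 = ⊤ := by
  refine eq_top_iff.2 fun x _ => ?_
  have h1 : (1 : Lam K V L) ∈ pathSpan K V L 0 := by
    rw [← sum_idem]
    exact sum_mem fun i _ => pathElt_mem_pathSpan (Quiver.Path.nil : Quiver.Path i i) (Nat.zero_le _)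
  simpa using smul_mem_of_stable (pathSpan K V L 0) (fun i m hm => idem_mul_mem_pathSpan i hm)
    (fun i j a m hm => pathSpan_antitone (Nat.zero_le 1) (arrowElt_mul_mem_pathSpan a hm)) x h1

theorem pathSpan_eq_bot {l : ℕ} (h : L < l) : pathSpan K V L l = ⊥ := by
  refine (Submodule.span_eq_bot).2 ?_
  rintro _ ⟨i, j, p, hp, rfl⟩
  exact pathElt_eq_zero p (h.trans_le hp)

theorem mul_mem_pathSpan {x y : Lam K V L} {l : ℕ} (hx : x ∈ pathSpan K V L 1)
    (hy : y ∈ pathSpan K V L l) : x * y ∈ pathSpan K V L (l + 1) := by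
  induction hx using Submodule.span_induction with
  | mem x h =>
    obtain ⟨k, m, p, hp, rfl⟩ := h
    cases p with
    | nil => simp at hp
    | cons p a =>
      rw [pathElt_cons, mul_assoc]
      refine arrowElt_mul_mem_pathSpan a ?_
      exact smul_mem_of_stable (pathSpan K V L l) (fun i m hm => idem_mul_mem_pathSpan i hm)
        (fun i j a m hm => pathSpan_antitone (Nat.le_succ l) (arrowElt_mul_mem_pathSpan a hm))
        (pathElt K L p) hy
  | zero => rw [zero_mul]; exact zero_mem _
  | add x y _ _ hx hy => rw [add_mul]; exact add_mem hx hy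
  | smul c x _ hx => rw [smul_mul_assoc]; exact Submodule.smul_mem _ _ hx

theorem isNilpotent_of_mem_pathSpan {x : Lam K V L} (hx : x ∈ pathSpan K V L 1) :
    IsNilpotent x := by
  have h : ∀ l : ℕ, x ^ l ∈ pathSpan K V L l := fun l => by
    induction l with
    | zero => rw [pathSpan_zero]; trivial
    | succ l ih => rw [pow_succ']; exact mul_mem_pathSpan hx ih
  refine ⟨L + 1, ?_⟩
  have := h (L + 1)
  rwa [pathSpan_eq_bot (Nat.lt_succ_self L), Submodule.mem_bot] at this

open Classical in
variable (K L) in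
/-- The one-dimensional representation of `Λ` on the simple module `S_i`. -/
def augmentation (i : V) : Lam K V L →ₐ[K] K :=
  RingQuot.liftAlgHom K ⟨FreeAlgebra.lift K fun g : Gen V =>
    match g with
    | .vertex j => if j = i then 1 else 0
    | .arrow _ => 0, fun s t h => by
      induction h with
      | orth j k => by_cases hjk : j = k <;> aesop
      | sum_one => simp
      | target_mul a => simp
      | mul_source a => simp
      | trunc p hp =>
        cases p with
        | nil => simp at hp
        | cons p a => simp [freePath]⟩

open Classical in
theorem augmentation_idem (i j : V) : augmentation K L i (idem K L j) = if j = i then 1 else 0 := by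
  exact (RingQuot.liftAlgHom_mkAlgHom_apply K _ _ _).trans (by simp)

theorem augmentation_arrowElt (i : V) {j k : V} (a : j ⟶ k) :
    augmentation K L i (arrowElt K L a) = 0 := by
  exact (RingQuot.liftAlgHom_mkAlgHom_apply K _ _ _).trans (by simp)

theorem augmentation_of_mem {x : Lam K V L} (hx : x ∈ pathSpan K V L 1) (i : V) :
    augmentation K L i x = 0 := by
  induction hx using Submodule.span_induction with
  | mem x h =>
    obtain ⟨k, m, p, hp, rfl⟩ := h
    cases p with
    | nil => simp at hp
    | cons p a => rw [pathElt_cons, map_mul, augmentation_arrowElt, zero_mul]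
  | zero => exact map_zero _
  | add x y _ _ hx hy => rw [map_add, hx, hy, add_zero]
  | smul c x _ hx => rw [map_smul, hx, smul_zero]

/-- Modulo the positive-length paths, `Λ` is spanned by the vertices, and the augmentations read off
the coefficients. This exhibits `pathSpan K V L 1` as a common kernel of algebra maps, hence as a
two-sided ideal. -/
theorem sub_augmentation_mem (x : Lam K V L) :
    x - ∑ i, augmentation K L i x • idem K L i ∈ pathSpan K V L 1 := by
  classical
  have hx : x ∈ pathSpan K V L 0 := by rw [pathSpan_zero]; trivial
  induction hx using Submodule.span_induction with
  | mem x h =>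
    obtain ⟨k, m, p, hp, rfl⟩ := h
    cases p with
    | nil =>
      rw [pathElt_nil, Finset.sum_eq_single k]
      · simp [augmentation_idem]
      · intro i _ hi; simp [augmentation_idem, hi.symm]
      · simp
    | cons p a =>
      have h := pathElt_mem_pathSpan (K := K) (L := L) (l := 1) (p.cons a) (by simp)
      simpa [augmentation_of_mem h] using h
  | zero => simp
  | add x y _ _ hx hy =>
    convert add_mem hx hy using 1
    simp only [map_add, add_smul, Finset.sum_add_distrib]
    abel
  | smul c x _ hx =>
    convert Submodule.smul_mem _ c hx using 1
    simp only [map_smul, smul_sub, Finset.smul_sum, smul_assoc]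

theorem mem_pathSpan_one_iff {x : Lam K V L} :
    x ∈ pathSpan K V L 1 ↔ ∀ i, augmentation K L i x = 0 := by
  refine ⟨augmentation_of_mem, fun h => ?_⟩
  simpa [h] using sub_augmentation_mem x

/-- Each augmentation maps onto the field `K`, whose radical is zero, so the radical lies in all
their kernels. Conversely, the positive-length paths span an ideal of nilpotent elements, so `1 + y
* x` is invertible for every `y`. -/
theorem mem_jacobson_iff {x : Lam K V L} :
    x ∈ Ring.jacobson (Lam K V L) ↔ x ∈ pathSpan K V L 1 := by
  constructor
  · refine fun hx => mem_pathSpan_one_iff.2 fun i => ?_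
    have hs : Function.Surjective (augmentation K L i).toRingHom := fun c =>
      ⟨algebraMap K _ c, (augmentation K L i).commutes c⟩
    have : RingHomSurjective (augmentation K L i).toRingHom := ⟨hs⟩
    have h := Ring.le_comap_jacobson (augmentation K L i).toRingHom hx
    have h0 : Ring.jacobson K = ⊥ := by
      rw [← Ideal.jacobson_bot]; exact Ideal.jacobson_eq_self_of_isMaximal
    rw [h0] at h
    exact h
  · intro hx
    rw [← Ideal.jacobson_bot, Ideal.mem_jacobson_iff]
    intro y
    have hy : y * x ∈ pathSpan K V L 1 :=
      mem_pathSpan_one_iff.2 fun i => by rw [map_mul, augmentation_of_mem hx, mul_zero]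
    obtain ⟨z, hz⟩ := (isNilpotent_of_mem_pathSpan hy).isUnit_one_add.exists_left_inv
    refine ⟨z, ?_⟩
    rw [Ideal.mem_bot, sub_eq_zero, ← hz, mul_assoc]
    noncomm_ring

end Radical

/-! ### Radical layers at the vertices -/

section VertexRad

variable {K : Type u} [Field K] {V : Type v} [Quiver.{w} V] [Fintype V] {L : ℕ}
variable {M : Type*} [AddCommGroup M] [Module (Lam K V L) M]

theorem arrowElt_mem_jacobson {i j : V} (a : i ⟶ j) :
    arrowElt K L a ∈ Ring.jacobson (Lam K V L) := by
  rw [mem_jacobson_iff]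
  refine Submodule.subset_span ⟨i, j, (Quiver.Path.nil).cons a, by simp, ?_⟩
  rw [pathElt_cons, pathElt_nil, arrowElt_mul_idem]

theorem radPow_succ (l : ℕ) : radPow K (V := V) L M (l + 1) =
    Ring.jacobson (Lam K V L) • radPow K (V := V) L M l := by
  rw [radPow, radPow, Ideal.IsTwoSided.pow_succ, Submodule.mul_smul]

theorem radPow_antitone : Antitone (radPow K (V := V) L M) :=
  antitone_nat_of_succ_le fun l => by rw [radPow_succ]; exact Submodule.smul_le_right

theorem jacobson_pow_le {l : ℕ} {x : Lam K V L} (hx : x ∈ Ring.jacobson (Lam K V L) ^ l) :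
    x ∈ pathSpan K V L l := by
  induction l generalizing x with
  | zero => rw [pathSpan_zero]; trivial
  | succ l ih =>
    rw [Ideal.IsTwoSided.pow_succ, ← Ideal.smul_eq_mul] at hx
    refine Submodule.smul_induction_on hx (fun r hr n hn => ?_) fun x y hx hy => add_mem hx hy
    exact mul_mem_pathSpan (mem_jacobson_iff.1 hr) (ih hn)

theorem radPow_eq_bot {l : ℕ} (h : L < l) : radPow K (V := V) L M l = ⊥ := by
  rw [eq_bot_iff]
  intro m hm
  rw [radPow] at hm
  refine Submodule.smul_induction_on hm (fun r hr n hn => ?_) fun x y hx hy => add_mem hx hy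
  have := jacobson_pow_le hr
  rw [pathSpan_eq_bot h, Submodule.mem_bot] at this
  rw [this, zero_smul]; exact zero_mem _

theorem radPow_zero : radPow K (V := V) L M 0 = ⊤ := by
  rw [radPow, Submodule.pow_zero, Ideal.one_eq_top, Submodule.top_smul]

theorem idem_smul_eq_zero {i j : V} (h : i ≠ j) {m : M} (hm : idem K L j • m = m) :
    idem K L i • m = 0 := by
  rw [← hm, smul_smul, idem_mul_ne h, zero_smul]

theorem arrowElt_smul_eq_zero {i j k : V} (a : i ⟶ j) (h : i ≠ k) {m : M}
    (hm : idem K L k • m = m) : arrowElt K L a • m = 0 := by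
  rw [← arrowElt_mul_idem, mul_smul, idem_smul_eq_zero h hm, smul_zero]

variable [Module K M] [IsScalarTower K (Lam K V L) M]

variable (K V L M) in
/-- The subspace `e_i J ^ l M` of `M`. -/
def vertexRad (l : ℕ) (i : V) : Submodule K M where
  carrier := {m | m ∈ radPow K (V := V) L M l ∧ idem K L i • m = m}
  add_mem' hm hn := ⟨add_mem hm.1 hn.1, by rw [smul_add, hm.2, hn.2]⟩
  zero_mem' := ⟨zero_mem _, smul_zero _⟩
  smul_mem' c m hm := ⟨Submodule.smul_of_tower_mem _ c hm.1, by rw [smul_comm, hm.2]⟩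

theorem mem_vertexRad {l : ℕ} {i : V} {m : M} :
    m ∈ vertexRad K V L M l i ↔ m ∈ radPow K (V := V) L M l ∧ idem K L i • m = m :=
  Iff.rfl

theorem mem_vertexRad_zero {i : V} {m : M} :
    m ∈ vertexRad K V L M 0 i ↔ idem K L i • m = m := by
  simp [mem_vertexRad, radPow_zero]

theorem vertexRad_antitone (i : V) : Antitone fun l => vertexRad K V L M l i :=
  fun _ _ h _ hm => ⟨radPow_antitone h hm.1, hm.2⟩

theorem vertexRad_eq_bot {l : ℕ} (h : L < l) (i : V) : vertexRad K V L M l i = ⊥ := by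
  rw [eq_bot_iff]
  intro m hm
  have h1 := hm.1
  rwa [radPow_eq_bot (K := K) (V := V) (M := M) h] at h1

theorem idem_smul_mem {l : ℕ} (i : V) {m : M} (hm : m ∈ radPow K (V := V) L M l) :
    idem K L i • m ∈ vertexRad K V L M l i :=
  ⟨Submodule.smul_mem _ _ hm, by rw [smul_smul, idem_mul_self]⟩

theorem arrowElt_smul_mem {l : ℕ} {i j : V} (a : i ⟶ j) {m : M}
    (hm : m ∈ radPow K (V := V) L M l) : arrowElt K L a • m ∈ vertexRad K V L M (l + 1) j := by
  refine ⟨?_, by rw [smul_smul, idem_mul_arrowElt]⟩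
  rw [radPow_succ]
  exact Submodule.smul_mem_smul (arrowElt_mem_jacobson a) hm

theorem pathElt_smul_mem {i j : V} (p : Quiver.Path i j) (m : M) :
    pathElt K L p • m ∈ vertexRad K V L M p.length j := by
  induction p with
  | nil => exact idem_smul_mem i (by simp [radPow_zero])
  | cons p a ih =>
    rw [pathElt_cons, mul_smul]
    exact arrowElt_smul_mem a ih.1

/-- The radical is spanned by paths of positive length. Splitting off the last arrow leaves an
element of `J ^ l M` at the source of that arrow, and `e_j` discards paths ending elsewhere. Thus
the filtration can be computed from the arrows alone. -/
theorem vertexRad_succ (l : ℕ) (j : V) : vertexRad K V L M (l + 1) j =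
    ⨆ a : Σ i, (i ⟶ j),
      (vertexRad K V L M l a.1).map (Algebra.lsmul K K M (arrowElt K L a.2)) := by
  apply le_antisymm
  · intro m hm
    suffices h : ∀ m ∈ radPow K (V := V) L M (l + 1), idem K L j • m ∈
        ⨆ a : Σ i, (i ⟶ j),
          (vertexRad K V L M l a.1).map (Algebra.lsmul K K M (arrowElt K L a.2)) by
      rw [← hm.2]; exact h m hm.1
    intro m hm
    rw [radPow_succ] at hm
    refine Submodule.smul_induction_on hm (fun r hr n hn => ?_)
      fun x y hx hy => by rw [smul_add]; exact add_mem hx hy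
    rw [mem_jacobson_iff] at hr
    induction hr using Submodule.span_induction with
    | mem x h =>
      obtain ⟨k, m, p, hp, rfl⟩ := h
      cases p with
      | nil => simp at hp
      | @cons i _ p a =>
        rcases eq_or_ne j m with rfl | hjm
        · rw [smul_smul, idem_mul_pathElt, pathElt_cons, mul_smul]
          refine Submodule.mem_iSup_of_mem ⟨i, a⟩ (Submodule.mem_map.2
            ⟨pathElt K L p • n, ⟨Submodule.smul_mem _ _ hn, ?_⟩, rfl⟩)
          rw [smul_smul, idem_mul_pathElt]
        · rw [smul_smul, idem_mul_pathElt_ne _ hjm, zero_smul]; exact zero_mem _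
    | zero => rw [zero_smul, smul_zero]; exact zero_mem _
    | add x y _ _ hx hy => rw [add_smul, smul_add]; exact add_mem hx hy
    | smul c x _ hx =>
      rw [smul_assoc, smul_comm]; exact Submodule.smul_mem _ _ hx
  · refine iSup_le fun a => ?_
    rintro _ ⟨m, hm, rfl⟩
    exact arrowElt_smul_mem a.2 hm.1

/-- Multiplication by an idempotent is exact, so `e_i` applied to the layer is the quotient of the
consecutive spaces `e_i J ^ l M`; then rank–nullity. -/
theorem radMult_add [Module.Finite K M] (l : ℕ) (i : V) :
    radMult K L M l i + Module.finrank K (vertexRad K V L M (l + 1) i) =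
      Module.finrank K (vertexRad K V L M l i) := by
  let f : vertexRad K V L M l i →ₗ[K] RadLayer K (V := V) L M l :=
    { toFun := fun m => Submodule.Quotient.mk ⟨m.1, m.2.1⟩
      map_add' := fun _ _ => rfl
      map_smul' := fun _ _ => rfl }
  have hr : LinearMap.range f =
      LinearMap.range (Algebra.lsmul K K (RadLayer K (V := V) L M l) (idem K L i)) := by
    ext z
    constructor
    · rintro ⟨m, rfl⟩
      refine ⟨f m, ?_⟩
      change Submodule.Quotient.mk (idem K L i • (⟨m.1, m.2.1⟩ : radPow K (V := V) L M l)) = _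
      congr 1
      exact Subtype.ext m.2.2
    · rintro ⟨z, rfl⟩
      obtain ⟨m, rfl⟩ := Submodule.Quotient.mk_surjective _ z
      exact ⟨⟨idem K L i • m.1, idem_smul_mem i m.2⟩, rfl⟩
  have hk : (LinearMap.ker f).map (vertexRad K V L M l i).subtype =
      vertexRad K V L M (l + 1) i := by
    ext m
    constructor
    · rintro ⟨m, hm, rfl⟩
      exact ⟨(Submodule.Quotient.mk_eq_zero (M := radPow K (V := V) L M l)
        (x := ⟨m.1, m.2.1⟩) _).1 hm, m.2.2⟩
    · intro hm
      exact ⟨⟨m, vertexRad_antitone i (Nat.le_succ l) hm⟩,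
        (Submodule.Quotient.mk_eq_zero _).2 hm.1, rfl⟩
  rw [radMult, ← hr, ← hk, Submodule.finrank_map_subtype_eq]
  exact LinearMap.finrank_range_add_finrank_ker f

end VertexRad

/-! ### Radical layerings in terms of adapted bases -/

section LevelSpan

variable {K : Type u} [Field K] {V : Type v} {M : Type*} [AddCommGroup M] [Module K M]
variable {ι : Type*} (b : ι → M) (lev : ι → ℕ) (vert : ι → V)

variable (K) in
/-- The span of the vectors `b t` of level at least `l` which belong to the vertex `i`. -/
def levelSpan (l : ℕ) (i : V) : Submodule K M :=
  Submodule.span K (b '' {t | l ≤ lev t ∧ vert t = i})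

variable {b lev vert}

theorem mem_levelSpan {l : ℕ} (t : ι) (h : l ≤ lev t) :
    b t ∈ levelSpan K b lev vert l (vert t) :=
  Submodule.subset_span ⟨t, ⟨h, rfl⟩, rfl⟩

theorem finrank_levelSpan (hb : LinearIndependent K b) (l : ℕ) (i : V) :
    Module.finrank K (levelSpan K b lev vert l i) =
      Nat.card {t // l ≤ lev t ∧ vert t = i} := by
  have h := Module.Basis.span (hb.comp (Subtype.val : {t // l ≤ lev t ∧ vert t = i} → ι)
    Subtype.val_injective)
  rw [Set.range_comp, Subtype.range_coe_subtype] at h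
  exact Module.finrank_eq_nat_card_basis h

end LevelSpan

section Layering

/-- The multiplicity of `S_i` in `⨁ m ≥ l, 𝕊_m`. -/
def tail {V : Type v} {L : ℕ} (S : Fin (L + 1) → V → ℕ) (l : ℕ) (i : V) : ℕ :=
  ∑ m : Fin (L + 1) with l ≤ m.1, S m i

theorem tail_eq_zero {V : Type v} {L : ℕ} (S : Fin (L + 1) → V → ℕ) {l : ℕ} (h : L < l) (i : V) :
    tail S l i = 0 := by
  refine Finset.sum_eq_zero fun m hm => ?_
  have := (Finset.mem_filter.1 hm).2
  omega

theorem tail_zero {V : Type v} {L : ℕ} (S : Fin (L + 1) → V → ℕ) (i : V) :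
    tail S 0 i = dimVec S i := by
  simp [tail, dimVec]

theorem tail_eq_add {V : Type v} {L : ℕ} (S : Fin (L + 1) → V → ℕ) (l : Fin (L + 1)) (i : V) :
    tail S l i = S l i + tail S (l + 1) i := by
  have h : (Finset.univ.filter fun m : Fin (L + 1) => (l : ℕ) ≤ m.1) =
      insert l (Finset.univ.filter fun m : Fin (L + 1) => (l : ℕ) + 1 ≤ m.1) := by
    ext m
    simp only [Finset.mem_filter, Finset.mem_univ, true_and, Finset.mem_insert, Fin.ext_iff]
    omega
  rw [tail, h, Finset.sum_insert (by simp), tail]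

variable {K : Type u} [Field K] {V : Type v} [Quiver.{w} V] [Fintype V] {L : ℕ}
variable {M : Type*} [AddCommGroup M] [Module K M] [Module (Lam K V L) M]
  [IsScalarTower K (Lam K V L) M]
variable {S : Fin (L + 1) → V → ℕ}

/-- Multiplicities of layers and dimensions of filtration steps determine each other by summation
from the bottom up, starting at `J ^ (L + 1) M = 0`. -/
theorem hasLayering_iff [Module.Finite K M] : HasLayering K S M ↔
    ∀ l i, Module.finrank K (vertexRad K V L M l i) = tail S l i := by
  constructor
  · intro h l i
    rcases Nat.lt_or_ge L l with hl | hl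
    · rw [vertexRad_eq_bot hl, tail_eq_zero S hl, finrank_bot]
    · induction hl using Nat.decreasingInduction with
      | of_succ k hk ih =>
        rw [← radMult_add, ih, tail_eq_add S ⟨k, Nat.lt_succ_of_lt hk⟩, ← h]
      | self =>
        rw [← radMult_add, vertexRad_eq_bot (Nat.lt_succ_self L), finrank_bot,
          tail_eq_add S ⟨L, Nat.lt_succ_self L⟩, ← h, tail_eq_zero S (Nat.lt_succ_self L)]
  · intro h l i
    have h1 := radMult_add (K := K) (V := V) (L := L) (M := M) l i
    rw [h, h, tail_eq_add S l i] at h1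
    omega

variable {ι : Type*} {b : ι → M} {lev : ι → ℕ} {vert : ι → V}

/-- A family of vectors in the radical layers prescribed by `lev` and `vert`, with as many
members in each layer as `S` asks for, spans the radical layers of a module with layering `S`. -/
theorem HasLayering.vertexRad_eq [Module.Finite K M] (h : HasLayering K S M)
    (hb : LinearIndependent K b) (hmem : ∀ t, b t ∈ vertexRad K V L M (lev t) (vert t))
    (hcard : ∀ l i, Nat.card {t // l ≤ lev t ∧ vert t = i} = tail S l i) (l : ℕ) (i : V) :
    vertexRad K V L M l i = levelSpan K b lev vert l i := by
  refine (Submodule.eq_of_le_of_finrank_eq ?_ ?_).symm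
  · refine Submodule.span_le.2 ?_
    rintro _ ⟨t, ⟨ht, rfl⟩, rfl⟩
    exact vertexRad_antitone _ ht (hmem t)
  · rw [finrank_levelSpan hb, hcard, hasLayering_iff.1 h]

/-- Along a basis on which all arrows raise the level, the radical powers are bounded
by the level. -/
theorem vertexRad_le_levelSpan (hb : Submodule.span K (Set.range b) = ⊤)
    (hv : ∀ t, idem K L (vert t) • b t = b t)
    (ha : ∀ (i j : V) (a : i ⟶ j) (t : ι), vert t = i →
      arrowElt K L a • b t ∈ levelSpan K b lev vert (lev t + 1) j) (l : ℕ) (i : V) :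
    vertexRad K V L M l i ≤ levelSpan K b lev vert l i := by
  induction l generalizing i with
  | zero =>
    intro m hm
    rw [← hm.2]
    have hm' : m ∈ Submodule.span K (Set.range b) := by rw [hb]; trivial
    clear hm
    induction hm' using Submodule.span_induction with
    | mem x h =>
      obtain ⟨t, rfl⟩ := h
      rcases eq_or_ne i (vert t) with rfl | hi
      · rw [hv]; exact mem_levelSpan t (Nat.zero_le _)
      · rw [idem_smul_eq_zero hi (hv t)]; exact zero_mem _
    | zero => rw [smul_zero]; exact zero_mem _
    | add x y _ _ hx hy => rw [smul_add]; exact add_mem hx hy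
    | smul c x _ hx => rw [smul_comm]; exact Submodule.smul_mem _ _ hx
  | succ l ih =>
    rw [vertexRad_succ]
    refine iSup_le fun a => le_trans (Submodule.map_mono (ih a.1)) ?_
    rw [levelSpan, Submodule.map_span_le]
    rintro _ ⟨t, ⟨ht, hi⟩, rfl⟩
    have hsub : {s | lev t + 1 ≤ lev s ∧ vert s = i} ⊆ {s | l + 1 ≤ lev s ∧ vert s = i} :=
      fun s hs => ⟨le_trans (Nat.succ_le_succ ht) hs.1, hs.2⟩
    exact Submodule.span_mono (Set.image_mono hsub) (ha _ _ a.2 t hi)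

/-- The membership `hmem` makes the radical powers large enough, and the fact that arrows raise the
level makes them no larger, so levels count the layers. -/
theorem hasLayering_of_basis [Module.Finite K M] (hli : LinearIndependent K b)
    (hb : Submodule.span K (Set.range b) = ⊤)
    (hmem : ∀ t, b t ∈ vertexRad K V L M (lev t) (vert t))
    (ha : ∀ (i j : V) (a : i ⟶ j) (t : ι), vert t = i →
      arrowElt K L a • b t ∈ levelSpan K b lev vert (lev t + 1) j)
    (hcard : ∀ l i, Nat.card {t // l ≤ lev t ∧ vert t = i} = tail S l i) :
    HasLayering K S M := by
  refine hasLayering_iff.2 fun l i => ?_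
  have : vertexRad K V L M l i = levelSpan K b lev vert l i := by
    refine le_antisymm (vertexRad_le_levelSpan hb (fun t => (hmem t).2) ha l i) ?_
    refine Submodule.span_le.2 ?_
    rintro _ ⟨t, ⟨ht, rfl⟩, rfl⟩
    exact vertexRad_antitone _ ht (hmem t)
  rw [this, finrank_levelSpan hli, hcard]

variable (K L b lev) in
/-- The span of the images of the `b t` of level at least `l` under the arrows ending in `j`. -/
def arrowSpan (l : ℕ) (j : V) : Submodule K M :=
  Submodule.span K (Set.range fun p : (Σ i, (i ⟶ j)) × {t // l ≤ lev t} =>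
    arrowElt K L p.1.2 • b p.2)

/-- In `arrowSpan` the arrow need not start at the vertex of the basis vector; the mismatched pairs
contribute zero. The resulting span of a fixed finite family can later be read as a column space
varying with a point. -/
theorem iSup_map_levelSpan (hv : ∀ t, idem K L (vert t) • b t = b t) (l : ℕ) (j : V) :
    ⨆ a : Σ i, (i ⟶ j), (levelSpan K b lev vert l a.1).map
      (Algebra.lsmul K K M (arrowElt K L a.2)) = arrowSpan K L b lev l j := by
  apply le_antisymm
  · refine iSup_le fun a => ?_
    rw [levelSpan, Submodule.map_span_le]
    rintro _ ⟨t, ⟨ht, hi⟩, rfl⟩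
    exact Submodule.subset_span ⟨(a, ⟨t, ht⟩), rfl⟩
  · refine Submodule.span_le.2 ?_
    rintro _ ⟨⟨⟨i, a⟩, ⟨t, ht⟩⟩, rfl⟩
    rcases eq_or_ne i (vert t) with rfl | hi
    · exact Submodule.mem_iSup_of_mem ⟨_, a⟩ (Submodule.mem_map_of_mem (mem_levelSpan t ht))
    · dsimp only
      rw [arrowElt_smul_eq_zero a hi (hv t)]; exact zero_mem _

/-- Along a basis on which all arrows raise the level, having layering `S` is a lower bound
on the dimensions of the spans `arrowSpan`. -/
theorem hasLayering_iff_le_finrank [Module.Finite K M] (hli : LinearIndependent K b)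
    (hb : Submodule.span K (Set.range b) = ⊤)
    (hv : ∀ t, idem K L (vert t) • b t = b t)
    (ha : ∀ (i j : V) (a : i ⟶ j) (t : ι), vert t = i →
      arrowElt K L a • b t ∈ levelSpan K b lev vert (lev t + 1) j)
    (hcard : ∀ l i, Nat.card {t // l ≤ lev t ∧ vert t = i} = tail S l i) :
    HasLayering K S M ↔ ∀ l ≤ L, ∀ j, tail S (l + 1) j ≤
      Module.finrank K (arrowSpan K L b lev l j) := by
  have hle := vertexRad_le_levelSpan (L := L) hb hv ha
  constructor
  · intro h l _ j
    have heq : ∀ i, vertexRad K V L M l i = levelSpan K b lev vert l i := fun i =>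
      Submodule.eq_of_le_of_finrank_eq (hle l i)
        (by rw [finrank_levelSpan hli, hcard, hasLayering_iff.1 h])
    have heq' : vertexRad K V L M (l + 1) j = arrowSpan K L b lev l j := by
      rw [vertexRad_succ]
      simp only [heq]
      exact iSup_map_levelSpan hv l j
    rw [← hasLayering_iff.1 h, heq']
  · intro h
    -- The upper bound `hle` is already known, so at each step the assumed lower bound on the
    -- dimension forces equality, which feeds the next step.
    have heq : ∀ l i, vertexRad K V L M l i = levelSpan K b lev vert l i := fun l => by
      induction l with
      | zero =>
        intro i
        refine le_antisymm (hle 0 i) (Submodule.span_le.2 ?_)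
        rintro _ ⟨t, ⟨ht, rfl⟩, rfl⟩
        exact mem_vertexRad_zero.2 (hv t)
      | succ l ih =>
        intro j
        refine Submodule.eq_of_le_of_finrank_le (hle (l + 1) j) ?_
        rw [finrank_levelSpan hli, hcard]
        rcases Nat.lt_or_ge L l with hl | hl
        · rw [tail_eq_zero S (by omega)]; exact Nat.zero_le _
        · refine (h l hl j).trans (le_of_eq ?_)
          have heq' : vertexRad K V L M (l + 1) j = arrowSpan K L b lev l j := by
            rw [vertexRad_succ]
            simp only [ih]
            exact iSup_map_levelSpan hv l j
          rw [heq']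
    refine hasLayering_iff.2 fun l i => ?_
    rw [heq, finrank_levelSpan hli, hcard]

end Layering

/-! ### The modules `M_x` -/

section RepModule

variable {K : Type u} [Field K] {V : Type v} [Quiver.{w} V] [Fintype V] {L : ℕ} {d : V → ℕ}

theorem action_mk (y : RepVar K L d) (f : FreeAlgebra K (Gen V)) :
    action y (Lam.mk K L f) = FreeAlgebra.lift K (genAct y.1) f :=
  RingQuot.liftAlgHom_mkAlgHom_apply K _ _ _

variable {y : RepVar K L d}

open Classical in
theorem idem_smul_rep (i : V) (m : RepModule y) :
    idem K L i • m = (Pi.single i (m i) : (i : V) → Fin (d i) → K) := by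
  change action y (Lam.mk K L _) m = _
  rw [action_mk, FreeAlgebra.lift_ι_apply]
  rfl

open Classical in
theorem arrowElt_smul_rep {i j : V} (a : i ⟶ j) (m : RepModule y) :
    arrowElt K L a • m = (Pi.single j ((arrowMat y.1 a).mulVec (m i)) : (i : V) → Fin (d i) → K) := by
  change action y (Lam.mk K L _) m = _
  rw [action_mk, FreeAlgebra.lift_ι_apply]
  rfl

open Classical in
theorem pathElt_smul_rep {i j : V} (p : Quiver.Path i j) (m : RepModule y) :
    pathElt K L p • m = (Pi.single j ((pathMat y.1 p).mulVec (m i)) : (i : V) → Fin (d i) → K) := by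
  change action y (Lam.mk K L _) m = _
  rw [action_mk, lift_freePath]
  rfl

instance : Module.Finite K (RepModule y) :=
  inferInstanceAs (Module.Finite K ((i : V) → Fin (d i) → K))

theorem finrank_repModule : Module.finrank K (RepModule y) = ∑ i, d i := by
  change Module.finrank K ((i : V) → Fin (d i) → K) = _
  rw [Module.finrank_pi_fintype]
  simp

omit [Fintype V] in
/-- If all arrows raise a level which is bounded by `L`, then the paths of length `L + 1` vanish. -/
theorem pathMat_eq_zero_of_level {x : Coord d → K} (lev : (i : V) → Fin (d i) → ℕ)
    (hL : ∀ i c, lev i c ≤ L)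
    (h : ∀ (i j : V) (a : i ⟶ j) r c, arrowMat x a r c ≠ 0 → lev i c < lev j r) {i j : V}
    (p : Quiver.Path i j) (hp : p.length = L + 1) : pathMat x p = 0 := by
  have key : ∀ {i j : V} (p : Quiver.Path i j) r c, pathMat x p r c ≠ 0 →
      lev i c + p.length ≤ lev j r := by
    intro i j p
    induction p with
    | nil =>
      intro r c hrc
      rw [pathMat] at hrc
      obtain rfl : r = c := by
        by_contra hne
        exact hrc (Matrix.one_apply_ne hne)
      simp
    | cons p a ih =>
      intro r c hrc
      rw [pathMat, Matrix.mul_apply] at hrc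
      obtain ⟨s, -, hs⟩ := Finset.exists_ne_zero_of_sum_ne_zero hrc
      have h1 := h _ _ a r s (left_ne_zero_of_mul hs)
      have h2 := ih s c (right_ne_zero_of_mul hs)
      rw [Quiver.Path.length_cons]
      omega
  ext r c
  by_contra hne
  have h1 := key p r c hne
  have h2 := hL j r
  omega

end RepModule

/-! ### Combinatorics of skeleta -/

section Skeleton

variable {V : Type v} [Quiver.{w} V] {L : ℕ} {S : Fin (L + 1) → V → ℕ} {σ : Finset (PPath S)}

theorem IsSkeleton.card_eq (hσ : IsSkeleton σ) (l : ℕ) (i : V) :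
    Nat.card {t : {u // u ∈ σ} // l ≤ t.1.path.length ∧ t.1.target = i} = tail S l i := by
  classical
  have h1 : Nat.card {t : {u // u ∈ σ} // l ≤ t.1.path.length ∧ t.1.target = i} =
      (σ.filter fun u => l ≤ u.path.length ∧ u.target = i).card := by
    rw [← Nat.card_congr (Equiv.subtypeSubtypeEquivSubtypeInter (· ∈ σ)
      fun u => l ≤ u.path.length ∧ u.target = i).symm]
    exact Nat.subtype_card _ fun u => Finset.mem_filter
  -- The paths are counted by length. `Fin.ofNat` reduces modulo `L + 1`, which is harmless as
  -- lengths in a skeleton are at most `L`.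
  rw [h1, tail, Finset.card_eq_sum_card_fiberwise
    (f := fun u : PPath S => (Fin.ofNat (L + 1) u.path.length))
    (t := Finset.univ.filter fun m : Fin (L + 1) => l ≤ m.1)]
  · refine Finset.sum_congr rfl fun m hm => ?_
    rw [← hσ.card_layer, Finset.filter_filter]
    congr 1
    have hm := (Finset.mem_filter.1 hm).2
    refine Finset.filter_congr fun u hu => ?_
    have hmod := Nat.mod_eq_of_lt (Nat.lt_succ_of_le (hσ.length_le u hu))
    rw [Fin.ext_iff, Fin.val_ofNat, hmod]
    constructor
    · rintro ⟨⟨_, h1⟩, h2⟩; exact ⟨h2, h1⟩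
    · rintro ⟨h1, h2⟩; exact ⟨⟨h1 ▸ hm, h2⟩, h1⟩
  · intro u hu
    obtain ⟨hu, h1, -⟩ := Finset.mem_filter.1 hu
    have hmod := Nat.mod_eq_of_lt (Nat.lt_succ_of_le (hσ.length_le u hu))
    refine Finset.mem_coe.2 (Finset.mem_filter.2 ⟨Finset.mem_univ _, ?_⟩)
    rwa [Fin.val_ofNat, hmod]

/-- There are only `S 0 i` paths of length zero at `i` altogether, and the layer count demands that
many. In particular every critical path has positive length. -/
theorem IsSkeleton.root_mem (hσ : IsSkeleton σ) (r : Top S) :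
    (⟨r, r.1, Quiver.Path.nil⟩ : PPath S) ∈ σ := by
  classical
  obtain ⟨i, k⟩ := r
  let T : Finset (PPath S) := Finset.univ.image fun k : Fin (S 0 i) => ⟨⟨i, k⟩, i, Quiver.Path.nil⟩
  have hT : (σ.filter fun u => u.path.length = ((0 : Fin (L + 1)) : ℕ) ∧ u.target = i) = T := by
    refine Finset.eq_of_subset_of_card_le ?_ ?_
    · rintro ⟨⟨j, k'⟩, t, p⟩ hu
      obtain ⟨-, hp, rfl⟩ := Finset.mem_filter.1 hu
      dsimp only at p hp ⊢
      cases p with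
      | nil => exact Finset.mem_image.2 ⟨k', Finset.mem_univ _, rfl⟩
      | cons p a => simp at hp
    · rw [hσ.card_layer]
      exact Finset.card_image_le.trans (by simp)
  have : (⟨⟨i, k⟩, i, Quiver.Path.nil⟩ : PPath S) ∈ T :=
    Finset.mem_image.2 ⟨k, Finset.mem_univ _, rfl⟩
  rw [← hT] at this
  exact (Finset.mem_filter.1 this).1

theorem IsSkeleton.mem_of_cons (hσ : IsSkeleton σ) {r : Top S} {i j : V} {p : Quiver.Path r.1 i}
    {a : i ⟶ j} (h : (⟨r, j, p.cons a⟩ : PPath S) ∈ σ) : (⟨r, i, p⟩ : PPath S) ∈ σ :=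
  hσ.initial_mem r i j p a.toPath h

/-- A critical path is obtained by adding an arrow to a path of the skeleton. -/
theorem IsSkeleton.isCritical_iff (hσ : IsSkeleton σ) {r : Top S} {i j : V}
    {p : Quiver.Path r.1 i} {a : i ⟶ j} :
    IsCritical σ (⟨r, j, p.cons a⟩ : PPath S) ↔ p.length + 1 ≤ L ∧
      (⟨r, j, p.cons a⟩ : PPath S) ∉ σ ∧ (⟨r, i, p⟩ : PPath S) ∈ σ := by
  constructor
  · rintro ⟨h1, h2, h3⟩
    exact ⟨h1, h2, h3 i p a.toPath rfl (by simp [Quiver.Hom.toPath])⟩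
  · rintro ⟨h1, h2, h3⟩
    refine ⟨h1, h2, fun k p' p'' h hpos => ?_⟩
    dsimp only at p' p'' h
    cases p'' with
    | nil => simp at hpos
    | cons p'' b =>
      rw [Quiver.Path.comp_cons] at h
      obtain rfl := Quiver.Path.obj_eq_of_cons_eq_cons h
      obtain rfl := eq_of_heq (Quiver.Path.heq_of_cons_eq_cons h)
      exact hσ.initial_mem r k i p' p'' h3

theorem par_eq_zero {R : Type*} [CommRing R] {x : Param σ → R} {q p : PPath S}
    (h : ¬ InSigma σ q p) : par x q p = 0 :=
  dif_neg fun h' => h h'.2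

theorem par_eq_zero' {R : Type*} [CommRing R] {x : Param σ → R} {q p : PPath S}
    (h : ¬ IsCritical σ q) : par x q p = 0 :=
  dif_neg fun h' => h h'.1

theorem aeval_par {R : Type*} [CommRing R] (x : Param σ → R) (q p : PPath S) :
    MvPolynomial.aeval x (par MvPolynomial.X q p : MvPolynomial (Param σ) ℤ) = par x q p := by
  unfold par
  split_ifs with h
  · rw [MvPolynomial.aeval_X]
  · rw [map_zero]

theorem arrowCoeff_of_ne {i j : V} (a : i ⟶ j) {u v : {u : PPath S // u ∈ σ}}
    (h : u.1.target ≠ i) : arrowCoeff a u v = 0 := dif_neg h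

theorem arrowCoeff_of_mem {r : Top S} {i j : V} {p : Quiver.Path r.1 i} (a : i ⟶ j)
    (hu : (⟨r, i, p⟩ : PPath S) ∈ σ) (h : (⟨r, j, p.cons a⟩ : PPath S) ∈ σ)
    [DecidableEq {u // u ∈ σ}] (v : {u // u ∈ σ}) :
    arrowCoeff a ⟨_, hu⟩ v = if v = ⟨_, h⟩ then 1 else 0 := by
  have h1 : arrowCoeff a ⟨_, hu⟩ v = @ite _ (v.1 = ⟨r, j, p.cons a⟩)
      (Classical.propDecidable _) 1 0 := (dif_pos rfl).trans (if_pos h)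
  rw [h1]
  by_cases hv : v = ⟨_, h⟩
  · rw [if_pos hv, if_pos (congrArg Subtype.val hv)]
  · rw [if_neg hv, if_neg fun h' => hv (Subtype.ext h')]

theorem arrowCoeff_of_notMem {r : Top S} {i j : V} {p : Quiver.Path r.1 i} (a : i ⟶ j)
    (hu : (⟨r, i, p⟩ : PPath S) ∈ σ) (h : (⟨r, j, p.cons a⟩ : PPath S) ∉ σ)
    (v : {u // u ∈ σ}) :
    arrowCoeff a ⟨_, hu⟩ v = par MvPolynomial.X (⟨r, j, p.cons a⟩ : PPath S) v.1 :=
  (dif_pos rfl).trans (if_neg h)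

/-- Either `v` is the path `a u`, or it lies in `σ(a u)` and is at least as long as `a u`. This
strict increase of length makes every family of parameters admissible. -/
theorem arrowCoeff_ne_zero {i j : V} (a : i ⟶ j) {u v : {u : PPath S // u ∈ σ}}
    (h : arrowCoeff a u v ≠ 0) :
    v.1.target = j ∧ u.1.path.length < v.1.path.length := by
  classical
  by_cases hi : u.1.target = i
  · obtain ⟨⟨r, t, p⟩, hu⟩ := u
    obtain rfl : t = i := hi
    by_cases hm : (⟨r, j, p.cons a⟩ : PPath S) ∈ σ
    · rw [arrowCoeff_of_mem a hu hm] at h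
      obtain rfl : v = ⟨_, hm⟩ := by
        by_contra hne
        exact h (if_neg hne)
      exact ⟨rfl, Nat.lt_succ_self _⟩
    · rw [arrowCoeff_of_notMem a hu hm] at h
      have h' : InSigma σ ⟨r, j, p.cons a⟩ v.1 := by
        by_contra hne
        exact h (par_eq_zero hne)
      exact ⟨h'.2.1, h'.2.2⟩
  · exact absurd (arrowCoeff_of_ne a hi) h

end Skeleton

/-! ### Presentations -/

section Presentation

variable {K : Type u} [Field K] {V : Type v} [Quiver.{w} V] [Fintype V] {L : ℕ}
  {S : Fin (L + 1) → V → ℕ}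
variable {M : Type*} [AddCommGroup M] [Module (Lam K V L) M]

/-- The homomorphism `P → M` which sends `z_r` to `m r`. -/
def projLift (m : Top S → M) : ProjCover S K →ₗ[Lam K V L] M :=
  ∑ r : Top S, (LinearMap.toSpanSingleton (Lam K V L) M (m r)).comp
    ((Submodule.subtype _).comp (LinearMap.proj r))

theorem idem_smul_topElt (r : Top S) : idem K L r.1 • topElt K r = topElt K r := by
  classical
  unfold topElt
  rw [← Pi.single_smul]
  congr 1
  exact Subtype.ext (idem_mul_self r.1)

theorem projLift_topElt {m : Top S → M} (hm : ∀ r, idem K L r.1 • m r = m r) (r : Top S) :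
    projLift m (topElt K r) = m r := by
  classical
  rw [projLift, LinearMap.sum_apply, Finset.sum_eq_single r]
  · simp [topElt, hm]
  · intro s _ hs
    simp [topElt, hs]
  · simp

theorem projLift_elt {m : Top S → M} (hm : ∀ r, idem K L r.1 • m r = m r) (u : PPath S) :
    projLift m (u.elt K) = pathElt K L u.path • m u.root := by
  rw [PPath.elt, map_smul, projLift_topElt hm]

theorem span_topElt : Submodule.span (Lam K V L) (Set.range (topElt (S := S) K)) = ⊤ := by
  classical
  refine eq_top_iff.2 fun z _ => ?_
  rw [← Finset.univ_sum_single z]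
  refine sum_mem fun r _ => ?_
  obtain ⟨c, hc⟩ := Submodule.mem_span_singleton.1 (z r).2
  have : Pi.single r (z r) = c • topElt K r := by
    unfold topElt
    rw [← Pi.single_smul]
    congr 1
    exact Subtype.ext hc.symm
  rw [this]
  exact Submodule.smul_mem _ _ (Submodule.subset_span ⟨r, rfl⟩)

variable [Module K M] [IsScalarTower K (Lam K V L) M] {σ : Finset (PPath S)} {x : Param σ → K}

variable (x) in
/-- The elements `m r` of `M` satisfy the relations which define `P / R(σ)_x`. -/
def SatisfiesRel (m : Top S → M) : Prop :=
  ∀ q : Crit σ, pathElt K L q.1.path • m q.1.root =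
    ∑ p ∈ σ, par x q.1 p • pathElt K L p.path • m p.root

/-- The homomorphism `P / R(σ)_x → M` which sends the class of `z_r` to `m r`. -/
def presLift (m : Top S → M) (hm : ∀ r, idem K L r.1 • m r = m r) (h : SatisfiesRel x m) :
    Pres x →ₗ[Lam K V L] M :=
  (relSub x).liftQ (projLift m) <| by
    refine Submodule.span_le.2 ?_
    rintro _ ⟨q, rfl⟩
    simp only [SetLike.mem_coe, LinearMap.mem_ker]
    rw [map_sub, projLift_elt hm, h q, map_sum, sub_eq_zero]
    refine Finset.sum_congr rfl fun p _ => ?_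
    rw [LinearMap.map_smul_of_tower, projLift_elt hm]

theorem presLift_topCls (m : Top S → M) (hm : ∀ r, idem K L r.1 • m r = m r)
    (h : SatisfiesRel x m) (r : Top S) : presLift m hm h (topCls x r) = m r :=
  projLift_topElt hm r

theorem cls_eq (u : PPath S) : cls x u = pathElt K L u.path • topCls x u.root := rfl

theorem presLift_cls (m : Top S → M) (hm : ∀ r, idem K L r.1 • m r = m r)
    (h : SatisfiesRel x m) (u : PPath S) :
    presLift m hm h (cls x u) = pathElt K L u.path • m u.root :=
  projLift_elt hm u

theorem idem_smul_topCls (r : Top S) : idem K L r.1 • topCls x r = topCls x r := by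
  rw [topCls, ← map_smul, idem_smul_topElt]

theorem span_topCls : Submodule.span (Lam K V L) (Set.range (topCls x)) = ⊤ := by
  have : Set.range (topCls x) = (relSub x).mkQ '' Set.range (topElt K) := by
    rw [← Set.range_comp]; rfl
  rw [this, ← Submodule.map_span, span_topElt, Submodule.map_top, Submodule.range_mkQ]

theorem satisfiesRel_topCls : SatisfiesRel x (topCls x) := by
  intro q
  have h : q.1.elt K - ∑ p ∈ σ, par x q.1 p • p.elt K ∈ relSub x :=
    Submodule.subset_span ⟨q, rfl⟩
  rw [← Submodule.ker_mkQ (relSub x), LinearMap.mem_ker, map_sub, sub_eq_zero, map_sum] at h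
  refine h.trans (Finset.sum_congr rfl fun p _ => ?_)
  rw [LinearMap.map_smul_of_tower]
  rfl

theorem SatisfiesRel.map {N : Type*} [AddCommGroup N] [Module (Lam K V L) N]
    [Module K N] [IsScalarTower K (Lam K V L) N] {m : Top S → M} (h : SatisfiesRel x m)
    (f : M →ₗ[Lam K V L] N) : SatisfiesRel x fun r => f (m r) := by
  intro q
  rw [← map_smul, h q, map_sum]
  refine Finset.sum_congr rfl fun p _ => ?_
  rw [LinearMap.map_smul_of_tower, map_smul]

omit [IsScalarTower K (Lam K V L) M] in
/-- The action of the arrows on the paths in `σ`, for generators satisfying the relations. -/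
theorem SatisfiesRel.arrowElt_smul (hσ : IsSkeleton σ) {m : Top S → M}
    (h : SatisfiesRel x m) {i j : V} (a : i ⟶ j) (u : {u // u ∈ σ}) :
    arrowElt K L a • pathElt K L u.1.path • m u.1.root =
      ∑ v : {u // u ∈ σ}, MvPolynomial.aeval x (arrowCoeff a u v) •
        pathElt K L v.1.path • m v.1.root := by
  classical
  by_cases hi : u.1.target = i
  · obtain ⟨⟨r, t, p⟩, hu⟩ := u
    obtain rfl : t = i := hi
    dsimp only at p ⊢
    rw [smul_smul, ← pathElt_cons]
    by_cases hmem : (⟨r, j, p.cons a⟩ : PPath S) ∈ σ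
    · rw [Finset.sum_eq_single ⟨_, hmem⟩]
      · rw [arrowCoeff_of_mem a hu hmem, if_pos rfl, map_one, one_smul]
      · intro v _ hv
        rw [arrowCoeff_of_mem a hu hmem, if_neg hv, map_zero, zero_smul]
      · simp
    · simp only [arrowCoeff_of_notMem a hu hmem, aeval_par]
      rw [Finset.sum_coe_sort σ fun v : PPath S => par x (⟨r, j, p.cons a⟩ : PPath S) v •
        pathElt K L v.path • m v.root]
      rcases Nat.lt_or_ge p.length L with hl | hl
      · exact h ⟨⟨r, j, p.cons a⟩, hσ.isCritical_iff.2 ⟨hl, hmem, hu⟩⟩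
      -- Here `a u` has length greater than `L` and is zero in `Λ`. It is not critical either, so
      -- all its coefficients take the default value `0` of `par`.
      · rw [pathElt_eq_zero _ (by rw [Quiver.Path.length_cons]; omega), zero_smul]
        refine (Finset.sum_eq_zero fun v _ => ?_).symm
        rw [par_eq_zero' fun hc => ?_, zero_smul]
        have := (hσ.isCritical_iff.1 hc).1
        omega
  · rw [arrowElt_smul_eq_zero a (Ne.symm hi) (by rw [smul_smul, idem_mul_pathElt])]
    simp [arrowCoeff_of_ne a hi]

/-- The action of the paths on the paths in `σ`, for generators satisfying the relations. -/
theorem SatisfiesRel.pathElt_smul (hσ : IsSkeleton σ) {m : Top S → M}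
    (h : SatisfiesRel x m) {i j : V} (p : Quiver.Path i j) (u : {u // u ∈ σ}) :
    pathElt K L p • pathElt K L u.1.path • m u.1.root =
      ∑ v : {u // u ∈ σ}, MvPolynomial.aeval x (pathCoeff σ p u v) •
        pathElt K L v.1.path • m v.1.root := by
  classical
  induction p with
  | nil =>
    simp only [pathElt_nil, pathCoeff]
    by_cases hi : u.1.target = i
    · rw [Finset.sum_eq_single u]
      · rw [if_pos ⟨hi, rfl⟩, map_one, one_smul, smul_smul, ← hi, idem_mul_pathElt]
      · intro v _ hv
        rw [if_neg fun h' => hv h'.2.symm, map_zero, zero_smul]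
      · simp
    · rw [smul_smul, idem_mul_pathElt_ne _ (Ne.symm hi), zero_smul]
      simp [hi]
  | cons p a ih =>
    rw [pathElt_cons, mul_smul, ih, Finset.smul_sum]
    simp only [pathCoeff, map_sum, map_mul, Finset.sum_smul, mul_smul]
    rw [Finset.sum_comm]
    refine Finset.sum_congr rfl fun t _ => ?_
    rw [smul_comm, h.arrowElt_smul hσ, Finset.smul_sum]

/-- The `K`-span of the classes is stable under vertices and arrows, hence a `Λ`-submodule, and it
contains the generators `z_r` because all lazy paths lie in `σ`. -/
theorem span_cls (hσ : IsSkeleton σ) (x : Param σ → K) :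
    Submodule.span K (Set.range fun u : {u // u ∈ σ} => cls x u.1) = ⊤ := by
  classical
  set W := Submodule.span K (Set.range fun u : {u // u ∈ σ} => cls x u.1) with hW
  have hmem : ∀ u : {u // u ∈ σ}, cls x u.1 ∈ W := fun u => Submodule.subset_span ⟨u, rfl⟩
  have hstab : ∀ (y : Lam K V L), ∀ m ∈ W, y • m ∈ W := by
    intro y m hm
    refine smul_mem_of_stable W (fun i m hm => ?_) (fun i j a m hm => ?_) y hm
    · induction hm using Submodule.span_induction with
      | mem _ h =>
        obtain ⟨u, rfl⟩ := h
        rcases eq_or_ne i u.1.target with rfl | hi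
        · dsimp only
          rw [cls_eq, smul_smul, idem_mul_pathElt]
          exact hmem u
        · dsimp only
          rw [cls_eq, smul_smul, idem_mul_pathElt_ne _ hi, zero_smul]
          exact zero_mem _
      | zero => rw [smul_zero]; exact zero_mem _
      | add x y _ _ hx hy => rw [smul_add]; exact add_mem hx hy
      | smul c x _ hx => rw [smul_comm]; exact Submodule.smul_mem _ _ hx
    · induction hm using Submodule.span_induction with
      | mem _ h =>
        obtain ⟨u, rfl⟩ := h
        dsimp only
        rw [cls_eq, satisfiesRel_topCls.arrowElt_smul hσ]
        exact sum_mem fun v _ => Submodule.smul_mem _ _ (hmem v)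
      | zero => rw [smul_zero]; exact zero_mem _
      | add x y _ _ hx hy => rw [smul_add]; exact add_mem hx hy
      | smul c x _ hx => rw [smul_comm]; exact Submodule.smul_mem _ _ hx
  refine eq_top_iff.2 fun z _ => ?_
  have hz : z ∈ Submodule.span (Lam K V L) (Set.range (topCls x)) := by
    rw [span_topCls]; trivial
  induction hz using Submodule.span_induction with
  | mem _ h =>
    obtain ⟨r, rfl⟩ := h
    have := hmem ⟨_, hσ.root_mem r⟩
    rwa [cls_eq, pathElt_nil, idem_smul_topCls] at this
  | zero => exact zero_mem _
  | add x y _ _ hx hy => exact add_mem (hx trivial) (hy trivial)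
  | smul c x _ hx => exact hstab c x (hx trivial)

end Presentation

/-! ### The representation with basis `σ` -/

section SkeletonPoint

variable {K : Type u} [Field K] {V : Type v} [Quiver.{w} V] {L : ℕ}
  {S : Fin (L + 1) → V → ℕ} {σ : Finset (PPath S)}

/-- A numbering of the paths in `σ` which end in `i`. -/
def fiberEquiv (hσ : IsSkeleton σ) (i : V) :
    {t : {u // u ∈ σ} // t.1.target = i} ≃ Fin (dimVec S i) :=
  Finite.equivFinOfCardEq (by simpa [tail_zero] using hσ.card_eq 0 i)

/-- The point of `Rep_d(Λ)` given by the action of the arrows on `P / R(σ)_x` with respect to the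
basis `σ`. -/
def skeletonPoint (hσ : IsSkeleton σ) (x : Param σ → K) : RepVar K L (dimVec S) :=
  ⟨fun c => MvPolynomial.aeval x (arrowCoeff c.2.2.1 ((fiberEquiv hσ c.1).symm c.2.2.2.2).1
      ((fiberEquiv hσ c.2.1).symm c.2.2.2.1).1), fun i j p hp => by
    refine pathMat_eq_zero_of_level
      (fun i c => ((fiberEquiv hσ i).symm c).1.1.path.length) ?_ ?_ p hp
    · exact fun i c => hσ.length_le _ ((fiberEquiv hσ i).symm c).1.2
    · intro i j a r c h
      refine (arrowCoeff_ne_zero a (u := ((fiberEquiv hσ i).symm c).1)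
        (v := ((fiberEquiv hσ j).symm r).1) fun h0 => h ?_).2
      rw [arrowMat, Matrix.of_apply, h0, map_zero]⟩

/-- The indexing of the coordinates of the representation by `σ`. -/
def sigmaEquiv (hσ : IsSkeleton σ) : {u // u ∈ σ} ≃ Σ i, Fin (dimVec S i) :=
  (Equiv.sigmaFiberEquiv fun u : {u // u ∈ σ} => u.1.target).symm.trans
    (Equiv.sigmaCongrRight (fiberEquiv hσ))

variable [Fintype V]

/-- The basis `σ` of the representation `skeletonPoint`. -/
def skeletonBasis (hσ : IsSkeleton σ) (x : Param σ → K) :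
    Module.Basis {u // u ∈ σ} K (RepModule (skeletonPoint hσ x)) :=
  (Pi.basis fun i => Pi.basisFun K (Fin (dimVec S i))).reindex (sigmaEquiv hσ).symm

variable (hσ : IsSkeleton σ) (x : Param σ → K)

open Classical in
theorem skeletonBasis_apply (u : {u // u ∈ σ}) : skeletonBasis hσ x u =
    (Pi.single u.1.target (Pi.single (fiberEquiv hσ u.1.target ⟨u, rfl⟩) 1) :
      (i : V) → Fin (dimVec S i) → K) := by
  refine (Module.Basis.reindex_apply (Pi.basis fun i => Pi.basisFun K (Fin (dimVec S i)))
    (sigmaEquiv hσ).symm u).trans ?_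
  rw [Equiv.symm_symm, Pi.basis_apply, Pi.basisFun_apply]
  rfl

theorem skeletonBasis_repr (m : RepModule (skeletonPoint hσ x)) (u : {u // u ∈ σ}) :
    (skeletonBasis hσ x).repr m u = m u.1.target (fiberEquiv hσ u.1.target ⟨u, rfl⟩) := by
  exact Module.Basis.repr_reindex_apply (Pi.basis fun i => Pi.basisFun K (Fin (dimVec S i)))
    m (sigmaEquiv hσ).symm u

theorem idem_smul_skeletonBasis (u : {u // u ∈ σ}) :
    idem K L u.1.target • skeletonBasis hσ x u = skeletonBasis hσ x u := by
  classical
  rw [idem_smul_rep, skeletonBasis_apply, Pi.single_eq_same]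

theorem arrowElt_smul_skeletonBasis {i j : V} (a : i ⟶ j) (u : {u // u ∈ σ}) :
    arrowElt K L a • skeletonBasis hσ x u =
      ∑ v, MvPolynomial.aeval x (arrowCoeff a u v) • skeletonBasis hσ x v := by
  classical
  by_cases hi : u.1.target = i
  swap
  · rw [arrowElt_smul_eq_zero a (Ne.symm hi) (idem_smul_skeletonBasis hσ x u)]
    simp [arrowCoeff_of_ne a hi]
  subst hi
  refine (skeletonBasis hσ x).ext_elem fun v => ?_
  rw [Module.Basis.repr_sum_self, skeletonBasis_repr, arrowElt_smul_rep]
  by_cases hj : v.1.target = j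
  · subst hj
    rw [Pi.single_eq_same, skeletonBasis_apply, Pi.single_eq_same, Matrix.mulVec_single_one]
    simp [arrowMat, skeletonPoint]
  · rw [Pi.single_eq_of_ne hj]
    have : arrowCoeff a u v = 0 := by
      by_contra hne
      exact hj (arrowCoeff_ne_zero a hne).1
    rw [this, map_zero]
    rfl

theorem pathElt_smul_skeletonBasis (u : {u // u ∈ σ}) :
    pathElt K L u.1.path • skeletonBasis hσ x ⟨_, hσ.root_mem u.1.root⟩ = skeletonBasis hσ x u := by
  classical
  obtain ⟨⟨r, t, p⟩, hu⟩ := u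
  dsimp only at p ⊢
  induction p with
  | nil => exact idem_smul_skeletonBasis hσ x ⟨_, hσ.root_mem r⟩
  | cons p a ih =>
    have hp := hσ.mem_of_cons hu
    rw [pathElt_cons, mul_smul, ih hp, arrowElt_smul_skeletonBasis,
      Finset.sum_eq_single ⟨_, hu⟩]
    · rw [arrowCoeff_of_mem a hp hu, if_pos rfl, map_one, one_smul]
    · intro v _ hv
      rw [arrowCoeff_of_mem a hp hu, if_neg hv, map_zero, zero_smul]
    · simp

/-- Removing the last arrow of a critical path leaves a path of `σ`, which acts on the top vectors
by producing a basis vector; the removed arrow then acts by exactly the coefficients of the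
relation. -/
theorem satisfiesRel_skeletonBasis :
    SatisfiesRel x fun r => skeletonBasis hσ x ⟨_, hσ.root_mem r⟩ := by
  classical
  rintro ⟨⟨r, t, p⟩, hq⟩
  dsimp only at p ⊢
  cases p with
  | nil => exact absurd (hσ.root_mem r) hq.2.1
  | cons p a =>
    obtain ⟨-, h1, h2⟩ := hσ.isCritical_iff.1 hq
    rw [pathElt_cons, mul_smul, pathElt_smul_skeletonBasis hσ x ⟨_, h2⟩,
      arrowElt_smul_skeletonBasis]
    rw [← Finset.sum_coe_sort σ fun v : PPath S => par x (⟨r, t, p.cons a⟩ : PPath S) v •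
        pathElt K L v.path • skeletonBasis hσ x ⟨_, hσ.root_mem v.root⟩]
    refine Finset.sum_congr rfl fun v _ => ?_
    rw [arrowCoeff_of_notMem a h2 h1, aeval_par, pathElt_smul_skeletonBasis hσ x v]

include hσ in
-- The relations hold in the representation on `K^σ`, so `P / R(σ)_x` maps to it. The classes go to
-- the basis indexed by `σ`, so they cannot have been dependent.
theorem linearIndependent_cls :
    LinearIndependent K fun u : {u // u ∈ σ} => cls x u.1 := by
  refine LinearIndependent.of_comp ((presLift _ (fun r => idem_smul_skeletonBasis hσ x ⟨_,
    hσ.root_mem r⟩) (satisfiesRel_skeletonBasis hσ x)).restrictScalars K) ?_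
  convert (skeletonBasis hσ x).linearIndependent using 1
  funext u
  exact (presLift_cls _ (fun r => idem_smul_skeletonBasis hσ x ⟨_, hσ.root_mem r⟩)
    (satisfiesRel_skeletonBasis hσ x) u.1).trans (pathElt_smul_skeletonBasis hσ x u)

/-- The basis of `P / R(σ)_x` formed by the classes of the paths in `σ`. -/
def clsBasis : Module.Basis {u // u ∈ σ} K (Pres x) :=
  Module.Basis.mk (linearIndependent_cls hσ x) (span_cls hσ x).ge

theorem clsBasis_apply (u : {u // u ∈ σ}) : clsBasis hσ x u = cls x u.1 := by
  simp [clsBasis]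

include hσ in
/-- A module with generators that satisfy the relations of `P / R(σ)_x`, and for which `σ` gives
a basis, is isomorphic to `P / R(σ)_x`. -/
theorem nonempty_presEquiv {M : Type*} [AddCommGroup M] [Module K M] [Module (Lam K V L) M]
    [IsScalarTower K (Lam K V L) M] {m : Top S → M} (hm : ∀ r, idem K L r.1 • m r = m r)
    (h : SatisfiesRel x m) (b : Module.Basis {u // u ∈ σ} K M)
    (hb : ∀ u, b u = pathElt K L u.1.path • m u.1.root) :
    Nonempty (Pres x ≃ₗ[Lam K V L] M) := by
  refine ⟨LinearEquiv.ofBijective (presLift m hm h) ?_⟩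
  have he : (presLift m hm h).restrictScalars K =
      ((clsBasis hσ x).equiv b (Equiv.refl _)).toLinearMap := by
    refine (clsBasis hσ x).ext fun u => ?_
    rw [LinearEquiv.coe_coe, Module.Basis.equiv_apply, clsBasis_apply]
    exact (presLift_cls _ hm h u.1).trans (hb u).symm
  have hf : ⇑(presLift m hm h) = ⇑((clsBasis hσ x).equiv b (Equiv.refl _)) :=
    congrArg (fun f : Pres x →ₗ[K] M => ⇑f) he
  rw [hf]
  exact LinearEquiv.bijective _

theorem nonempty_presEquiv_skeletonPoint :
    Nonempty (Pres x ≃ₗ[Lam K V L] RepModule (skeletonPoint hσ x)) :=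
  nonempty_presEquiv hσ x (fun r => idem_smul_skeletonBasis hσ x ⟨_, hσ.root_mem r⟩)
    (satisfiesRel_skeletonBasis hσ x) (skeletonBasis hσ x)
    fun u => (pathElt_smul_skeletonBasis hσ x u).symm

/-- Lengths of paths serve as levels: a path of length `l` applied to a top vector lies in `J ^ l
M`, and arrows raise lengths. -/
theorem skeletonPoint_mem : skeletonPoint hσ x ∈ RepS K S := by
  refine hasLayering_of_basis (b := skeletonBasis hσ x) (lev := fun u => u.1.path.length)
    (vert := fun u => u.1.target) (skeletonBasis hσ x).linearIndependent
    (skeletonBasis hσ x).span_eq (fun u => ?_) (fun i j a u hu => ?_) hσ.card_eq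
  · rw [← pathElt_smul_skeletonBasis]
    exact pathElt_smul_mem _ _
  · rw [arrowElt_smul_skeletonBasis]
    refine sum_mem fun v _ => ?_
    by_cases h0 : arrowCoeff a u v = 0
    · rw [h0, map_zero, zero_smul]; exact zero_mem _
    · obtain ⟨rfl, h2⟩ := arrowCoeff_ne_zero a h0
      exact Submodule.smul_mem _ _ (Submodule.subset_span ⟨v, ⟨h2, rfl⟩, rfl⟩)

end SkeletonPoint

/-! ### Endomorphisms of `P / R(σ)_x` and solutions of the system -/

section Endomorphisms

variable {K : Type u} [Field K] {V : Type v} [Quiver.{w} V] {L : ℕ}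
  {S : Fin (L + 1) → V → ℕ} {σ : Finset (PPath S)}

theorem coef_of_target {k : Unknown σ → K} {j : Top S} {u : {u // u ∈ σ}}
    (h : u.1.target = j.1) : coef k j u = k ⟨(j, u), h⟩ := dif_pos h

theorem coef_of_ne {k : Unknown σ → K} {j : Top S} {u : {u // u ∈ σ}}
    (h : u.1.target ≠ j.1) : coef k j u = 0 := dif_neg h

variable [Fintype V]

/-- Since `coef` extends the unknowns by zero to all pairs `(j, u)`, the end-vertex constraint can
be dropped from sums. -/
theorem sum_unknown [Fintype (Unknown σ)] (F : Top S → {u // u ∈ σ} → K) (k : Unknown σ → K) :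
    ∑ ju : Unknown σ, F ju.1.1 ju.1.2 * k ju = ∑ j, ∑ u, F j u * coef k j u := by
  classical
  rw [← Fintype.sum_prod_type' (f := fun j u => F j u * coef k j u),
    ← Fintype.sum_subtype_add_sum_subtype
      (fun ju : Top S × {u // u ∈ σ} => ju.2.1.target = ju.1.1)
      (fun ju => F ju.1 ju.2 * coef k ju.1 ju.2),
    Finset.sum_eq_zero (s := (Finset.univ : Finset {ju : Top S × {u // u ∈ σ} //
      ¬ ju.2.1.target = ju.1.1})) fun ju _ => by rw [coef_of_ne ju.2, mul_zero], add_zero]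
  refine Finset.sum_congr (by ext; simp) fun ju _ => ?_
  rw [coef_of_target ju.2]

variable (x : Param σ → K)

/-- The elements `∑ u, k_{j,u} u` of `P / R(σ)_x`. -/
def combination (k : Unknown σ → K) (j : Top S) : Pres x :=
  ∑ u : {u // u ∈ σ}, coef k j u • cls x u.1

theorem idem_smul_combination (k : Unknown σ → K) (j : Top S) :
    idem K L j.1 • combination x k j = combination x k j := by
  rw [combination, Finset.smul_sum]
  refine Finset.sum_congr rfl fun u _ => ?_
  by_cases h : u.1.target = j.1
  · rw [smul_comm, cls_eq, smul_smul, ← h, idem_mul_pathElt]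
  · rw [coef_of_ne h, zero_smul, smul_zero]

variable (hσ : IsSkeleton σ)
include hσ

theorem repr_combination (k : Unknown σ → K) (j : Top S) (u : {u // u ∈ σ}) :
    (clsBasis hσ x).repr (combination x k j) u = coef k j u := by
  simp only [combination, ← clsBasis_apply hσ x]
  rw [Module.Basis.repr_sum_self]

theorem repr_pathElt_smul_combination (k : Unknown σ → K) (j : Top S) {s t : V}
    (p : Quiver.Path s t) (v : {u // u ∈ σ}) :
    (clsBasis hσ x).repr (pathElt K L p • combination x k j) v =
      ∑ u, MvPolynomial.aeval x (pathCoeff σ p u v) * coef k j u := by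
  have h : pathElt K L p • combination x k j =
      ∑ w, (∑ u, MvPolynomial.aeval x (pathCoeff σ p u w) * coef k j u) • clsBasis hσ x w := by
    simp only [Finset.sum_smul]
    rw [Finset.sum_comm, combination, Finset.smul_sum]
    refine Finset.sum_congr rfl fun u _ => ?_
    rw [smul_comm, cls_eq, satisfiesRel_topCls.pathElt_smul hσ, Finset.smul_sum]
    refine Finset.sum_congr rfl fun w _ => ?_
    rw [mul_comm, mul_smul, clsBasis_apply]
    rfl
  rw [h, Module.Basis.repr_sum_self]

/-- The row `(q, v)` of the system measures the `v`-coordinate of the failure of the relation at `q`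
for the candidate images `∑ u, k_{j,u} u`. -/
theorem system_mulVec {_ : Fintype (Unknown σ)} (k : Unknown σ → K) (q : Crit σ)
    (v : {u // u ∈ σ}) :
    ((system σ).map (MvPolynomial.aeval x)).mulVec k (q, v) =
      (clsBasis hσ x).repr (pathElt K L q.1.path • combination x k q.1.root -
        ∑ p ∈ σ, par x q.1 p • pathElt K L p.path • combination x k p.root) v := by
  classical
  have h1 : ((system σ).map (MvPolynomial.aeval x)).mulVec k (q, v) =
      ∑ j, ∑ u, ((if q.1.root = j then MvPolynomial.aeval x (pathCoeff σ q.1.path u v) else 0) -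
        ∑ p : {u // u ∈ σ}, if p.1.root = j then
          par x q.1 p.1 * MvPolynomial.aeval x (pathCoeff σ p.1.path u v) else 0) *
            coef k j u := by
    rw [← sum_unknown]
    refine Finset.sum_congr rfl fun ju _ => ?_
    congr 1
    simp only [system, Matrix.map_apply, Matrix.of_apply, map_sub, map_sum, apply_ite
      (MvPolynomial.aeval x), map_mul, map_zero, aeval_par]
  rw [h1, map_sub, Finsupp.sub_apply, map_sum, Finsupp.finsetSum_apply,
    repr_pathElt_smul_combination]
  simp only [sub_mul, Finset.sum_sub_distrib, map_smul, Finsupp.smul_apply, smul_eq_mul,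
    repr_pathElt_smul_combination, ite_mul, zero_mul, Finset.sum_mul]
  congr 1
  · rw [Finset.sum_eq_single q.1.root]
    · simp
    · intro j _ hj; simp [hj.symm]
    · simp
  · rw [← Finset.sum_coe_sort σ fun p => par x q.1 p * ∑ u,
      MvPolynomial.aeval x (pathCoeff σ p.path u v) * coef k p.root u]
    simp only [Finset.mul_sum]
    calc _ = ∑ j, ∑ p : {u // u ∈ σ}, ∑ u, if p.1.root = j then
          par x q.1 p.1 * MvPolynomial.aeval x (pathCoeff σ p.1.path u v) * coef k j u else 0 :=
          Finset.sum_congr rfl fun j _ => Finset.sum_comm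
      _ = _ := by
        rw [Finset.sum_comm]
        refine Finset.sum_congr rfl fun p _ => ?_
        rw [Finset.sum_eq_single p.1.root]
        · simp [mul_assoc]
        · intro j _ hj; simp [hj.symm]
        · simp

theorem mem_solutions_iff (k : Unknown σ → K) :
    k ∈ solutions x ↔ SatisfiesRel x (combination x k) := by
  rw [solutions, LinearMap.mem_ker]
  constructor
  · intro h q
    rw [← sub_eq_zero]
    refine (clsBasis hσ x).ext_elem fun v => ?_
    refine (system_mulVec x hσ k q v).symm.trans ((congrFun h (q, v)).trans ?_)
    simp
  · intro h
    funext ⟨q, v⟩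
    refine (system_mulVec x hσ k q v).trans ?_
    rw [h q, sub_self]
    simp

/-- The scalars which describe an endomorphism of `P / R(σ)_x`. -/
def endScalars : Module.End (Lam K V L) (Pres x) →ₗ[K] Unknown σ → K where
  toFun φ ju := (clsBasis hσ x).repr (φ (topCls x ju.1.1)) ju.1.2
  map_add' φ ψ := by funext ju; simp
  map_smul' c φ := by funext ju; simp

/-- The image of `z_j` is fixed by `e(j)`, so its coordinates at paths ending in other vertices
vanish, and the restricted set of unknowns loses no information. -/
theorem combination_endScalars (φ : Module.End (Lam K V L) (Pres x)) (j : Top S) :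
    combination x (endScalars x hσ φ) j = φ (topCls x j) := by
  refine (clsBasis hσ x).ext_elem fun u => ?_
  rw [repr_combination]
  by_cases h : u.1.target = j.1
  · rw [coef_of_target h]; rfl
  · rw [coef_of_ne h]
    have h1 : idem K L j.1 • φ (topCls x j) = φ (topCls x j) := by
      rw [← map_smul, idem_smul_topCls]
    rw [← h1]
    conv_rhs => rw [← (clsBasis hσ x).sum_repr (φ (topCls x j)), Finset.smul_sum]
    rw [map_sum, Finsupp.finsetSum_apply]
    refine (Finset.sum_eq_zero fun w _ => ?_).symm
    rw [smul_comm, map_smul, Finsupp.smul_apply]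
    by_cases hw : w.1.target = j.1
    · rw [clsBasis_apply, cls_eq, smul_smul, ← hw, idem_mul_pathElt, ← cls_eq,
        ← clsBasis_apply hσ x, Module.Basis.repr_self, Finsupp.single_eq_of_ne, smul_zero]
      rintro rfl
      exact h hw
    · rw [clsBasis_apply, cls_eq, smul_smul, idem_mul_pathElt_ne _ (Ne.symm hw)]
      simp

theorem endScalars_injective : Function.Injective (endScalars x hσ) := by
  intro φ ψ h
  refine LinearMap.ext_on (span_topCls (x := x)) ?_
  rintro _ ⟨j, rfl⟩
  rw [← combination_endScalars x hσ, h, combination_endScalars]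

/-- This is the universal property of the presentation: images of the `z_j` in the right vertex
spaces extend to an endomorphism exactly when they satisfy the defining relations. -/
theorem range_endScalars : LinearMap.range (endScalars x hσ) = solutions x := by
  ext k
  rw [mem_solutions_iff x hσ]
  constructor
  · rintro ⟨φ, rfl⟩
    have : combination x (endScalars x hσ φ) = fun r => φ (topCls x r) :=
      funext fun j => combination_endScalars x hσ φ j
    rw [this]
    exact satisfiesRel_topCls.map φ
  · intro h
    refine ⟨presLift _ (idem_smul_combination x k) h, ?_⟩
    funext ju
    change (clsBasis hσ x).repr (presLift _ (idem_smul_combination x k) h (topCls x ju.1.1))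
      ju.1.2 = _
    rw [presLift_topCls, repr_combination, coef_of_target ju.2]

/-- Endomorphisms of `P / R(σ)_x` correspond to solutions of the system at `x`. -/
def endEquivSolutions : Module.End (Lam K V L) (Pres x) ≃ₗ[K] solutions x :=
  (LinearEquiv.ofInjective (endScalars x hσ) (endScalars_injective x hσ)).trans
    (LinearEquiv.ofEq _ _ (range_endScalars x hσ))

theorem apply_topCls_eq_sum (φ : Module.End (Lam K V L) (Pres x)) (j : Top S) :
    φ (topCls x j) = ∑ u : {u // u ∈ σ}, coef (endEquivSolutions x hσ φ).1 j u • cls x u.1 :=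
  (combination_endScalars x hσ φ j).symm

end Endomorphisms

/-! ### Ranks of matrices -/

open Matrix

section Rank

variable {F : Type*} [Field F] {m n : Type*} [Finite m] [Fintype n]

theorem exists_submatrix_of_le_rank (A : Matrix m n F) {r : ℕ} (h : r ≤ A.rank) :
    ∃ g : Fin r → n, LinearIndependent F (A.submatrix id g).col := by
  rw [Matrix.rank_eq_finrank_span_cols] at h
  obtain ⟨f, hf, -, hli⟩ := Submodule.exists_fun_fin_finrank_span_eq F (Set.range A.col)
  choose g hg using hf
  have hf : f = fun k => A.col (g k) := funext fun k => (hg k).symm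
  subst hf
  exact ⟨g ∘ Fin.castLE h, hli.comp _ (Fin.castLE_injective h)⟩

/-- The rank of a matrix is at least `r` if and only if some minor of size `r` is not zero. -/
theorem le_rank_iff (A : Matrix m n F) (r : ℕ) :
    r ≤ A.rank ↔ ∃ (f : Fin r → m) (g : Fin r → n), (A.submatrix f g).det ≠ 0 := by
  have := Fintype.ofFinite m
  constructor
  · intro h
    obtain ⟨g, hg⟩ := exists_submatrix_of_le_rank A h
    -- Once `r` independent columns are chosen, passing to the transpose lets the same selection
    -- lemma choose the rows.
    have hr : (A.submatrix id g)ᵀ.rank = r := by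
      rw [Matrix.rank_transpose, Matrix.rank_eq_finrank_span_cols, finrank_span_eq_card hg,
        Fintype.card_fin]
    obtain ⟨f, hf⟩ := exists_submatrix_of_le_rank _ hr.ge
    refine ⟨f, g, ?_⟩
    rw [← Matrix.det_transpose]
    exact ((Matrix.isUnit_iff_isUnit_det _).1
      (Matrix.linearIndependent_cols_iff_isUnit.1 hf)).ne_zero
  · rintro ⟨f, g, h⟩
    have hu : IsUnit (A.submatrix f g) := (Matrix.isUnit_iff_isUnit_det _).2 h.isUnit
    have h1 := Matrix.rank_of_isUnit _ hu
    rw [Fintype.card_fin] at h1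
    exact h1 ▸ Matrix.rank_submatrix_le A f g

end Rank

/-! ### Polynomial functions and the Zariski topology -/

section Zariski

open Topology

variable {K : Type*} [Field K] {ι κ : Type*}

/-- A function on affine space which is given by a polynomial. -/
def IsPoly (f : (ι → K) → K) : Prop := ∃ p : MvPolynomial ι K, ∀ x, MvPolynomial.eval x p = f x

theorem IsPoly.const (c : K) : IsPoly fun _ : ι → K => c :=
  ⟨MvPolynomial.C c, fun _ => MvPolynomial.eval_C c⟩

theorem IsPoly.coord (i : ι) : IsPoly fun x : ι → K => x i :=
  ⟨MvPolynomial.X i, fun _ => MvPolynomial.eval_X i⟩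

theorem IsPoly.mul {f g : (ι → K) → K} (hf : IsPoly f) (hg : IsPoly g) :
    IsPoly fun x => f x * g x := by
  obtain ⟨p, hp⟩ := hf
  obtain ⟨q, hq⟩ := hg
  exact ⟨p * q, fun x => by rw [map_mul, hp, hq]⟩

theorem IsPoly.sub {f g : (ι → K) → K} (hf : IsPoly f) (hg : IsPoly g) :
    IsPoly fun x => f x - g x := by
  obtain ⟨p, hp⟩ := hf
  obtain ⟨q, hq⟩ := hg
  exact ⟨p - q, fun x => by rw [map_sub, hp, hq]⟩

theorem IsPoly.sum {α : Type*} (s : Finset α) {f : α → (ι → K) → K} (hf : ∀ a, IsPoly (f a)) :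
    IsPoly fun x => ∑ a ∈ s, f a x := by
  choose p hp using hf
  exact ⟨∑ a ∈ s, p a, fun x => by simp [hp]⟩

theorem IsPoly.ite {p : Prop} [Decidable p] {f g : (ι → K) → K} (hf : IsPoly f)
    (hg : IsPoly g) : IsPoly fun x => if p then f x else g x := by
  split_ifs
  · exact hf
  · exact hg

theorem IsPoly.comp {f : (κ → K) → K} (hf : IsPoly f) {φ : (ι → K) → κ → K}
    (hφ : ∀ k, IsPoly fun x => φ x k) : IsPoly fun x => f (φ x) := by
  obtain ⟨p, hp⟩ := hf
  choose q hq using hφ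
  refine ⟨MvPolynomial.bind₁ q p, fun x => ?_⟩
  beta_reduce
  rw [← hp, MvPolynomial.eval, MvPolynomial.eval₂Hom_bind₁]
  congr 2
  funext k
  exact hq k x

theorem IsPoly.det {n : Type*} [Fintype n] [DecidableEq n] {A : (ι → K) → Matrix n n K}
    (hA : ∀ i j, IsPoly fun x => A x i j) : IsPoly fun x => (A x).det := by
  choose p hp using hA
  refine ⟨(Matrix.of p).det, fun x => ?_⟩
  rw [RingHom.map_det]
  congr 1
  ext i j
  exact hp i j x

theorem IsPoly.mulMatrix {l m n : Type*} [Fintype m] {A : (ι → K) → Matrix l m K}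
    {B : (ι → K) → Matrix m n K} (hA : ∀ i j, IsPoly fun x => A x i j)
    (hB : ∀ i j, IsPoly fun x => B x i j) (i : l) (j : n) : IsPoly fun x => (A x * B x) i j := by
  simp only [Matrix.mul_apply]
  exact IsPoly.sum _ fun k => (hA i k).mul (hB k j)

theorem IsPoly.adjugate {n : Type*} [Fintype n] [DecidableEq n] {A : (ι → K) → Matrix n n K}
    (hA : ∀ i j, IsPoly fun x => A x i j) (i j : n) : IsPoly fun x => (A x).adjugate i j := by
  simp only [Matrix.adjugate_apply]
  refine IsPoly.det fun k l => ?_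
  simp only [Matrix.updateRow_apply]
  exact IsPoly.ite (IsPoly.const _) (hA k l)

theorem IsPoly.isOpen_ne_zero {f : (ι → K) → K} (hf : IsPoly f) :
    IsOpen[zariski ι K] {x | f x ≠ 0} := by
  obtain ⟨p, hp⟩ := hf
  refine TopologicalSpace.isOpen_generateFrom_of_mem ⟨p, ?_⟩
  simp only [hp]

theorem continuous_of_isPoly {φ : (ι → K) → κ → K} (hφ : ∀ k, IsPoly fun x => φ x k) :
    @Continuous _ _ (zariski ι K) (zariski κ K) φ := by
  refine continuous_generateFrom_iff.2 ?_
  rintro _ ⟨p, rfl⟩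
  exact (IsPoly.comp ⟨p, fun _ => rfl⟩ hφ).isOpen_ne_zero

/-- The set is the union of the non-vanishing sets of the minors of size `r`. -/
theorem isOpen_le_rank {m n : Type*} [Finite m] [Fintype n] {A : (ι → K) → Matrix m n K}
    (hA : ∀ i j, IsPoly fun x => A x i j) (r : ℕ) :
    IsOpen[zariski ι K] {x | r ≤ (A x).rank} := by
  simp only [le_rank_iff, Set.ofPred_exists]
  let _ := zariski ι K
  exact isOpen_iUnion fun f => isOpen_iUnion fun g =>
    (IsPoly.det fun i j => hA (f i) (g j)).isOpen_ne_zero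

/-- The topology is only generated by the non-vanishing sets; since products of polynomials realize
intersections, these sets form a basis. -/
theorem exists_eval_ne_zero_subset {U : Set (ι → K)} (hU : IsOpen[zariski ι K] U) {x : ι → K}
    (hx : x ∈ U) : ∃ p : MvPolynomial ι K, MvPolynomial.eval x p ≠ 0 ∧
      ∀ y, MvPolynomial.eval y p ≠ 0 → y ∈ U := by
  induction hU with
  | basic s hs =>
    obtain ⟨p, rfl⟩ := hs
    exact ⟨p, hx, fun _ h => h⟩
  | univ => exact ⟨1, by simp, fun _ _ => trivial⟩
  | inter s t _ _ hs ht =>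
    obtain ⟨p, hp, hp'⟩ := hs hx.1
    obtain ⟨q, hq, hq'⟩ := ht hx.2
    refine ⟨p * q, by simp [hp, hq], fun y hy => ?_⟩
    rw [map_mul] at hy
    exact ⟨hp' y (left_ne_zero_of_mul hy), hq' y (right_ne_zero_of_mul hy)⟩
  | sUnion T _ hT =>
    obtain ⟨s, hs, hxs⟩ := hx
    obtain ⟨p, hp, hp'⟩ := hT s hs hxs
    exact ⟨p, hp, fun y hy => ⟨s, hs, hp' y hy⟩⟩

theorem exists_eval_ne_zero [Infinite K] {p : MvPolynomial ι K} (hp : p ≠ 0) :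
    ∃ x, MvPolynomial.eval x p ≠ 0 := by
  by_contra! h
  exact hp (MvPolynomial.funext fun x => by rw [h, map_zero])

variable (ι K) in
theorem isPreirreducible_univ_zariski [Infinite K] :
    @IsPreirreducible _ (zariski ι K) (Set.univ : Set (ι → K)) := by
  rintro U W hU hW ⟨x, -, hx⟩ ⟨y, -, hy⟩
  obtain ⟨p, hp, hp'⟩ := exists_eval_ne_zero_subset hU hx
  obtain ⟨q, hq, hq'⟩ := exists_eval_ne_zero_subset hW hy
  have hpq : p * q ≠ 0 := mul_ne_zero (fun h => hp (by rw [h, map_zero]))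
    fun h => hq (by rw [h, map_zero])
  obtain ⟨z, hz⟩ := exists_eval_ne_zero hpq
  rw [map_mul] at hz
  exact ⟨z, trivial, hp' z (left_ne_zero_of_mul hz), hq' z (right_ne_zero_of_mul hz)⟩

end Zariski

/-! ### Solutions of linear systems with polynomial coefficients -/

section Generic

variable {m n P : Type*} [Finite m] [Fintype n] (A : Matrix m n (MvPolynomial P ℤ))

theorem le_rank_map_iff {F : Type*} [Field F] (x : P → F) (r : ℕ) :
    r ≤ (A.map (MvPolynomial.aeval x)).rank ↔ ∃ (f : Fin r → m) (g : Fin r → n),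
      MvPolynomial.aeval x (A.submatrix f g).det ≠ 0 := by
  rw [le_rank_iff]
  refine exists_congr fun f => exists_congr fun g => ?_
  rw [AlgHom.map_det]
  rfl

variable {k K : Type*} [Field k] [Field K] [Algebra k K]

theorem aeval_map_intCast (x : P → K) (D : MvPolynomial P ℤ) :
    MvPolynomial.aeval x (MvPolynomial.map (Int.castRingHom k) D) = MvPolynomial.aeval x D := by
  induction D using MvPolynomial.induction_on with
  | C a => simp
  | add p q hp hq => rw [map_add, map_add, hp, hq, map_add]
  | mul_X p i hp => rw [map_mul, map_mul, hp, MvPolynomial.map_X, map_mul,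
      MvPolynomial.aeval_X, MvPolynomial.aeval_X]

theorem map_intCast_eq_aeval {Q : Type*} [Field Q] (φ : MvPolynomial P k →+* Q)
    (D : MvPolynomial P ℤ) :
    MvPolynomial.aeval (fun i => φ (MvPolynomial.X i)) D =
      φ (MvPolynomial.map (Int.castRingHom k) D) := by
  induction D using MvPolynomial.induction_on with
  | C a => simp
  | add p q hp hq => rw [map_add, hp, hq, map_add, map_add]
  | mul_X p i hp =>
    rw [map_mul, hp, map_mul, map_mul, MvPolynomial.aeval_X, MvPolynomial.map_X]

/-- The rank at a generic point over `k` is determined by the minors which do not vanish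
identically over `k`. -/
theorem le_rank_generic_iff {Q : Type*} [Field Q] (φ : MvPolynomial P k →+* Q)
    (hφ : Function.Injective φ) (r : ℕ) :
    r ≤ (A.map (MvPolynomial.aeval fun i => φ (MvPolynomial.X i))).rank ↔
      ∃ (f : Fin r → m) (g : Fin r → n),
        MvPolynomial.map (Int.castRingHom k) (A.submatrix f g).det ≠ 0 := by
  rw [le_rank_map_iff]
  refine exists_congr fun f => exists_congr fun g => not_congr ?_
  rw [map_intCast_eq_aeval, map_eq_zero_iff φ hφ]

/-- A minor that is nonzero at `x` cannot be the zero polynomial over `k`: specialization only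
lowers the rank. -/
theorem rank_map_le_generic {Q : Type*} [Field Q] (φ : MvPolynomial P k →+* Q)
    (hφ : Function.Injective φ) (x : P → K) :
    (A.map (MvPolynomial.aeval x)).rank ≤
      (A.map (MvPolynomial.aeval fun i => φ (MvPolynomial.X i))).rank := by
  rw [le_rank_generic_iff A φ hφ]
  obtain ⟨f, g, h⟩ := (le_rank_map_iff A x _).1 le_rfl
  refine ⟨f, g, fun h0 => h ?_⟩
  rw [← aeval_map_intCast (k := k), h0, map_zero]

theorem rank_map_eq_generic_of_algebraicIndependent {Q : Type*} [Field Q]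
    (φ : MvPolynomial P k →+* Q) (hφ : Function.Injective φ) {x : P → K}
    (hx : AlgebraicIndependent k x) :
    (A.map (MvPolynomial.aeval x)).rank =
      (A.map (MvPolynomial.aeval fun i => φ (MvPolynomial.X i))).rank := by
  -- Algebraic independence is injectivity of evaluation at `x`, so `x` itself is a generic point
  -- over `k` with values in `K`.
  have h := le_rank_generic_iff A (MvPolynomial.aeval x : MvPolynomial P k →ₐ[k] K).toRingHom hx
  have hx' : (fun i => (MvPolynomial.aeval x : MvPolynomial P k →ₐ[k] K).toRingHom
      (MvPolynomial.X i)) = x := funext fun i => MvPolynomial.aeval_X x i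
  rw [hx'] at h
  exact eq_of_forall_le_iff fun r => (h r).trans (le_rank_generic_iff A φ hφ r).symm

/-- A single maximal nonzero minor over `k` stays nonzero over `K`, and a nonzero polynomial over an
infinite field has a non-root. No algebraically independent family in `K` is needed. -/
theorem exists_rank_map_eq_generic {Q : Type*} [Field Q] (φ : MvPolynomial P k →+* Q)
    (hφ : Function.Injective φ) [Infinite K] :
    ∃ x : P → K, (A.map (MvPolynomial.aeval x)).rank =
      (A.map (MvPolynomial.aeval fun i => φ (MvPolynomial.X i))).rank := by
  obtain ⟨f, g, h⟩ := (le_rank_generic_iff A φ hφ _).1 le_rfl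
  have h' : MvPolynomial.map (algebraMap k K)
      (MvPolynomial.map (Int.castRingHom k) (A.submatrix f g).det) ≠ 0 := fun h0 =>
    h (MvPolynomial.map_injective _ (algebraMap k K).injective (by rw [h0, map_zero]))
  obtain ⟨x, hx⟩ := exists_eval_ne_zero h'
  refine ⟨x, le_antisymm (rank_map_le_generic A φ hφ x) ((le_rank_map_iff A x _).2 ⟨f, g, ?_⟩)⟩
  rwa [MvPolynomial.eval_map, ← MvPolynomial.aeval_def, aeval_map_intCast] at hx

end Generic

/-! ### Generic dimension of the solution space -/

section Solutions

variable {V : Type v} [Quiver.{w} V] {L : ℕ}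
  {S : Fin (L + 1) → V → ℕ} {σ : Finset (PPath S)}

section

variable [Fintype V] [∀ i j : V, Fintype (i ⟶ j)]

/-- A critical path is a path of the finite set `σ` extended by one of finitely many arrows. The map
`F` takes an irrelevant value when path and arrow do not compose. -/
theorem IsSkeleton.finite_crit (hσ : IsSkeleton σ) : Finite (Crit σ) := by
  classical
  let F : {u // u ∈ σ} × (Σ (i : V) (j : V), (i ⟶ j)) → PPath S := fun z =>
    if h : z.1.1.target = z.2.1 then
      ⟨z.1.1.root, z.2.2.1, (z.1.1.path.cast rfl h).cons z.2.2.2⟩ else z.1.1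
  refine ((Set.finite_range F).subset ?_).to_subtype
  rintro ⟨r, t, p⟩ hq
  cases p with
  | nil => exact absurd (hσ.root_mem r) hq.2.1
  | cons p a => exact ⟨(⟨_, (hσ.isCritical_iff.1 hq).2.2⟩, ⟨_, _, a⟩), dif_pos rfl⟩

end

theorem finrank_solutions_add_rank [Fintype V] {F : Type*} [Field F] (inst : Fintype (Unknown σ))
    (x : Param σ → F) :
    ((system σ).map (MvPolynomial.aeval x)).rank + Module.finrank F (solutions x) =
      Fintype.card (Unknown σ) := by
  -- Rank and `solutions` may be formed with different enumerations of the unknowns; they are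
  -- identified before rank–nullity is applied.
  have key : ∀ (i₁ i₂ : Fintype (Unknown σ)), i₁ = i₂ →
      Module.finrank F (LinearMap.range
        (@Matrix.mulVecLin _ _ _ _ i₁ ((system σ).map (MvPolynomial.aeval x)))) +
      Module.finrank F (LinearMap.ker
        (@Matrix.mulVecLin _ _ _ _ i₂ ((system σ).map (MvPolynomial.aeval x)))) =
      @Fintype.card _ i₁ := by
    rintro i₁ _ rfl
    rw [LinearMap.finrank_range_add_finrank_ker, Module.finrank_fintype_fun_eq_card]
  exact key _ _ (Subsingleton.elim _ _)

variable (K : Type u) [Field K]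

variable (σ) in
/-- The polynomial ring over the prime field of `K`, embedded into its field of fractions. -/
def genericHom : MvPolynomial (Param σ) (⊥ : Subfield K) →+*
    FractionRing (MvPolynomial (Param σ) (⊥ : Subfield K)) :=
  algebraMap _ _

variable (σ) in
theorem genericHom_injective : Function.Injective (genericHom σ K) :=
  IsFractionRing.injective _ _

variable {K} [Fintype V]

theorem genericSolutionDim_eq :
    genericSolutionDim σ K =
      Module.finrank (FractionRing (MvPolynomial (Param σ) (⊥ : Subfield K)))
        (solutions fun i => genericHom σ K (MvPolynomial.X i)) := rfl

variable [∀ i j : V, Fintype (i ⟶ j)]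

theorem genericSolutionDim_le (hσ : IsSkeleton σ) (x : Param σ → K) :
    genericSolutionDim σ K ≤ Module.finrank K (solutions x) := by
  have := hσ.finite_crit
  have inst := Fintype.ofFinite (Unknown σ)
  have h1 := finrank_solutions_add_rank inst x
  have h2 := finrank_solutions_add_rank inst fun i => genericHom σ K (MvPolynomial.X i)
  have h3 := rank_map_le_generic (system σ) (genericHom σ K) (genericHom_injective σ K) x
  rw [genericSolutionDim_eq]
  omega

theorem exists_finrank_solutions_eq (hσ : IsSkeleton σ) [Infinite K] :
    ∃ x : Param σ → K, Module.finrank K (solutions x) = genericSolutionDim σ K := by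
  have := hσ.finite_crit
  have inst := Fintype.ofFinite (Unknown σ)
  obtain ⟨x, hx⟩ := exists_rank_map_eq_generic (K := K) (system σ) (genericHom σ K)
    (genericHom_injective σ K)
  have h1 := finrank_solutions_add_rank inst x
  have h2 := finrank_solutions_add_rank inst fun i => genericHom σ K (MvPolynomial.X i)
  refine ⟨x, ?_⟩
  rw [genericSolutionDim_eq]
  omega

theorem finrank_solutions_eq (hσ : IsSkeleton σ) {x : Param σ → K}
    (hx : AlgebraicIndependent (⊥ : Subfield K) x) :
    Module.finrank K (solutions x) = genericSolutionDim σ K := by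
  have := hσ.finite_crit
  have inst := Fintype.ofFinite (Unknown σ)
  have h1 := finrank_solutions_add_rank inst x
  have h2 := finrank_solutions_add_rank inst fun i => genericHom σ K (MvPolynomial.X i)
  have h3 := rank_map_eq_generic_of_algebraicIndependent (system σ) (genericHom σ K)
    (genericHom_injective σ K) hx
  rw [genericSolutionDim_eq]
  omega

end Solutions

/-! ### Irreducibility of `Rep 𝕊` -/

theorem isPoly_single {ι : Type*} {K : Type*} [Field K] {V : Type*} [DecidableEq V] {d : V → ℕ} {j : V}
    {f : (ι → K) → Fin (d j) → K}
    (hf : ∀ s, IsPoly fun x => f x s) (k : V) (s : Fin (d k)) :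
    IsPoly fun x => (Pi.single j (f x) : (i : V) → Fin (d i) → K) k s := by
  by_cases h : k = j
  · subst h
    simpa using hf s
  · simpa [Pi.single_eq_of_ne h] using IsPoly.const (ι := ι) (0 : K)

/-! ### Division of the coordinates into radical levels -/

section LevelIndex

variable {V : Type v} {L : ℕ} (S : Fin (L + 1) → V → ℕ)

/-- The level of a coordinate of `K ^ d_i`, under a division of the coordinates into blocks of the
sizes `S 0 i, …, S L i`. -/
def coordLevel (i : V) (c : Fin (dimVec S i)) : ℕ :=
  ((finSigmaFinEquiv (n := fun l => S l i)).symm c).1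

theorem coordLevel_le (i : V) (c : Fin (dimVec S i)) : coordLevel S i c ≤ L :=
  Nat.lt_succ_iff.1 ((finSigmaFinEquiv (n := fun l => S l i)).symm c).1.2

theorem card_coordLevel (l : ℕ) (i : V) :
    Nat.card {t : Σ i, Fin (dimVec S i) // l ≤ coordLevel S t.1 t.2 ∧ t.1 = i} = tail S l i := by
  let e : {s : Σ m, Fin (S m i) // l ≤ s.1.1} ≃
      {t : Σ i, Fin (dimVec S i) // l ≤ coordLevel S t.1 t.2 ∧ t.1 = i} :=
    { toFun := fun s => ⟨⟨i, finSigmaFinEquiv s.1⟩, by simpa [coordLevel] using s.2, rfl⟩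
      invFun := fun t => ⟨finSigmaFinEquiv.symm (t.2.2 ▸ t.1.2), by
        obtain ⟨⟨j, c⟩, h, rfl⟩ := t
        exact h⟩
      left_inv := fun s => by simp
      right_inv := by
        rintro ⟨⟨j, c⟩, h, rfl⟩
        exact Subtype.ext (congrArg (Sigma.mk j) (Equiv.apply_symm_apply _ _)) }
  rw [← Nat.card_congr e, Nat.subtype_card
    ((Finset.univ.filter fun m : Fin (L + 1) => l ≤ m.1).sigma fun _ => Finset.univ)
    fun s => by simp, Finset.card_sigma, tail]
  simp

end LevelIndex

/-! ### Columns of matrices as bases of a representation -/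

section Columns

variable {K : Type u} [Field K] {V : Type v} [Quiver.{w} V] {L : ℕ} {d : V → ℕ}

open Classical in
/-- The columns of a family of matrices, as elements of `⨁ i, K ^ (d i)`. -/
def colVec (g : (i : V) → Matrix (Fin (d i)) (Fin (d i)) K) (t : Σ i, Fin (d i)) :
    (i : V) → Fin (d i) → K :=
  Pi.single t.1 ((g t.1).col t.2)

/-- The columns of a family of matrices, as elements of the module `M_y`. -/
def colRep (y : RepVar K L d) (g : (i : V) → Matrix (Fin (d i)) (Fin (d i)) K)
    (t : Σ i, Fin (d i)) : RepModule y :=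
  colVec g t

theorem colRep_apply {y : RepVar K L d} (g : (i : V) → Matrix (Fin (d i)) (Fin (d i)) K)
    (i : V) (c : Fin (d i)) : colRep y g ⟨i, c⟩ i = (g i).col c := by
  simp [colRep, colVec]

variable [Fintype V]

/-- The columns of a family of invertible matrices form a basis. -/
def colBasis (g : (i : V) → Matrix (Fin (d i)) (Fin (d i)) K) (hg : ∀ i, (g i).det ≠ 0) :
    Module.Basis (Σ i, Fin (d i)) K ((i : V) → Fin (d i) → K) :=
  Pi.basis fun i =>
    have hli : LinearIndependent K (g i).col := Matrix.linearIndependent_cols_iff_isUnit.2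
      ((Matrix.isUnit_iff_isUnit_det _).2 (hg i).isUnit)
    Module.Basis.mk hli (hli.span_eq_top_of_card_eq_finrank' (by simp)).ge

omit [Quiver.{w} V] in
theorem colBasis_apply (g : (i : V) → Matrix (Fin (d i)) (Fin (d i)) K)
    (hg : ∀ i, (g i).det ≠ 0) (t : Σ i, Fin (d i)) : colBasis g hg t = colVec g t := by
  classical
  rw [colBasis, Pi.basis_apply, Module.Basis.mk_apply, colVec]

omit [Quiver.{w} V] in
theorem coe_colBasis (g : (i : V) → Matrix (Fin (d i)) (Fin (d i)) K)
    (hg : ∀ i, (g i).det ≠ 0) : ⇑(colBasis g hg) = colVec g :=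
  funext (colBasis_apply g hg)

theorem idem_smul_colRep {y : RepVar K L d}
    (g : (i : V) → Matrix (Fin (d i)) (Fin (d i)) K) (t : Σ i, Fin (d i)) :
    idem K L t.1 • colRep y g t = colRep y g t := by
  classical
  rw [idem_smul_rep]
  unfold colRep colVec
  rw [Pi.single_eq_same]

theorem linearIndependent_colRep {y : RepVar K L d}
    {g : (i : V) → Matrix (Fin (d i)) (Fin (d i)) K} (hg : ∀ i, (g i).det ≠ 0) :
    LinearIndependent K (colRep y g) := by
  have h := (colBasis g hg).linearIndependent
  rw [coe_colBasis] at h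
  exact h

theorem span_colRep {y : RepVar K L d}
    {g : (i : V) → Matrix (Fin (d i)) (Fin (d i)) K} (hg : ∀ i, (g i).det ≠ 0) :
    Submodule.span K (Set.range (colRep y g)) = ⊤ := by
  have h := (colBasis g hg).span_eq
  rw [coe_colBasis] at h
  exact h

end Columns

/-! ### Polynomial parametrization by conjugating level-raising representations -/

section Conjugation

open Topology

variable {K : Type u} [Field K] {V : Type v} [Quiver.{w} V] {L : ℕ} (S : Fin (L + 1) → V → ℕ)

/-- Index set of the entries of a family of square matrices together with a point
of the representation space. -/
abbrev ConjIndex : Type (max v w) :=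
  (Σ i : V, Fin (dimVec S i) × Fin (dimVec S i)) ⊕ Coord (dimVec S)

variable {S}

/-- The square matrix at the vertex `i`. -/
def conjMat (θ : ConjIndex S → K) (i : V) : Matrix (Fin (dimVec S i)) (Fin (dimVec S i)) K :=
  Matrix.of fun r c => θ (.inl ⟨i, r, c⟩)

/-- The representation in which the entries that do not raise the level are replaced by zero. -/
def lowPoint (θ : ConjIndex S → K) (c : Coord (dimVec S)) : K :=
  if coordLevel S c.1 c.2.2.2.2 < coordLevel S c.2.1 c.2.2.2.1 then θ (.inr c) else 0

/-- The conjugate of `lowPoint` by `conjMat`, up to nonzero scalars if the matrices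
are invertible. -/
def conjCoord (θ : ConjIndex S → K) (c : Coord (dimVec S)) : K :=
  (conjMat θ c.2.1 * arrowMat (lowPoint θ) c.2.2.1 * (conjMat θ c.1).adjugate) c.2.2.2.1 c.2.2.2.2

theorem arrowMat_conjCoord (θ : ConjIndex S → K) {i j : V} (a : i ⟶ j) :
    arrowMat (conjCoord θ) a = conjMat θ j * arrowMat (lowPoint θ) a * (conjMat θ i).adjugate :=
  rfl

theorem arrowMat_lowPoint_ne_zero {θ : ConjIndex S → K} {i j : V} (a : i ⟶ j) {r c}
    (h : arrowMat (lowPoint θ) a r c ≠ 0) : coordLevel S i c < coordLevel S j r := by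
  by_contra hlt
  exact h (if_neg hlt)

/-- At each inner vertex the product `adj(g) g` collapses to the scalar `det g`. Positive length is
needed: the lazy path acts as `1`, which is no multiple of `g adj(g)` when `g` is singular (and of
positive size). Singular `g` is allowed so that the parametrization is defined on the whole affine
space. -/
theorem exists_pathMat_conjCoord (θ : ConjIndex S → K) {i j : V} (p : Quiver.Path i j)
    (hp : 0 < p.length) : ∃ c : K, pathMat (conjCoord θ) p =
      c • (conjMat θ j * pathMat (lowPoint θ) p * (conjMat θ i).adjugate) := by
  induction p with
  | nil => simp at hp
  | @cons k l p a ih =>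
    rcases Nat.eq_zero_or_pos p.length with h0 | hpos
    · cases p with
      | nil => exact ⟨1, by simp [pathMat, arrowMat_conjCoord]⟩
      | cons p b => simp at h0
    · obtain ⟨c, hc⟩ := ih hpos
      refine ⟨c * (conjMat θ k).det, ?_⟩
      rw [pathMat, hc, arrowMat_conjCoord, pathMat, Matrix.mul_smul, mul_smul]
      congr 1
      calc _ = conjMat θ l * arrowMat (lowPoint θ) a * ((conjMat θ k).adjugate * conjMat θ k) *
            pathMat (lowPoint θ) p * (conjMat θ i).adjugate := by simp only [Matrix.mul_assoc]
        _ = _ := by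
          rw [Matrix.adjugate_mul]
          simp only [Matrix.mul_smul, Matrix.smul_mul, Matrix.mul_one, Matrix.mul_assoc]

/-- The conjugate of `lowPoint` by `conjMat` as a point of `Rep_d(Λ)`. -/
def conjPoint (θ : ConjIndex S → K) : RepVar K L (dimVec S) :=
  ⟨conjCoord θ, fun i j p hp => by
    obtain ⟨c, hc⟩ := exists_pathMat_conjCoord θ p (by omega)
    rw [hc, pathMat_eq_zero_of_level (coordLevel S) (coordLevel_le S)
      (fun i j a r c => arrowMat_lowPoint_ne_zero a) p hp]
    simp⟩

theorem isPoly_conjMat (i : V) (r c : Fin (dimVec S i)) :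
    IsPoly fun θ : ConjIndex S → K => conjMat θ i r c :=
  IsPoly.coord (ι := ConjIndex S) (Sum.inl ⟨i, r, c⟩)

theorem isPoly_conjCoord (c : Coord (dimVec S)) :
    IsPoly fun θ : ConjIndex S → K => conjCoord θ c :=
  IsPoly.mulMatrix (IsPoly.mulMatrix (isPoly_conjMat _)
    fun _ _ => IsPoly.ite (IsPoly.coord _) (IsPoly.const 0))
    (IsPoly.adjugate (isPoly_conjMat _)) _ _

theorem continuous_conjPoint :
    @Continuous _ _ (zariski (ConjIndex S) K) _ (conjPoint (K := K) (S := S)) :=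
  continuous_induced_rng.2 (continuous_of_isPoly isPoly_conjCoord)

variable [Fintype V]

/-- Expressed in the columns of `g`, the conjugated representation is the level-raising one again;
using the adjugate instead of the inverse costs the factor `det g_i`. -/
theorem arrowElt_smul_colRep (θ : ConjIndex S → K) {i j : V} (a : i ⟶ j)
    (c : Fin (dimVec S i)) :
    arrowElt K L a • colRep (conjPoint θ) (conjMat θ) ⟨i, c⟩ =
      ∑ r, ((conjMat θ i).det * arrowMat (lowPoint θ) a r c) •
        colRep (conjPoint θ) (conjMat θ) ⟨j, r⟩ := by
  classical
  rw [arrowElt_smul_rep]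
  have h1 : (arrowMat (conjPoint θ).1 a).mulVec ((conjMat θ i).col c) =
      ∑ r, ((conjMat θ i).det * arrowMat (lowPoint θ) a r c) • (conjMat θ j).col r := by
    change (arrowMat (conjCoord θ) a).mulVec _ = _
    rw [← Matrix.mulVec_single_one, Matrix.mulVec_mulVec, arrowMat_conjCoord, Matrix.mul_assoc,
      Matrix.adjugate_mul, Matrix.mul_smul, Matrix.mul_one, Matrix.mulVec_single_one]
    funext s
    simp [Matrix.mul_apply, Matrix.col_apply, Finset.mul_sum, mul_comm, mul_left_comm]
  rw [colRep_apply, h1]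
  change LinearMap.single K (fun i => Fin (dimVec S i) → K) j _ = _
  rw [map_sum]
  refine Finset.sum_congr rfl fun r _ => ?_
  rw [map_smul]
  simp only [colRep, colVec, LinearMap.single_apply]
  congr!

theorem conjPoint_mem_iff {θ : ConjIndex S → K} (hθ : ∀ i, (conjMat θ i).det ≠ 0) :
    conjPoint θ ∈ RepS K S ↔ ∀ l ≤ L, ∀ j, tail S (l + 1) j ≤ Module.finrank K
      (arrowSpan K L (colRep (conjPoint θ) (conjMat θ))
        (fun t => coordLevel S t.1 t.2) l j) := by
  refine hasLayering_iff_le_finrank (vert := fun t => t.1)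
    (linearIndependent_colRep hθ) (span_colRep hθ)
    (idem_smul_colRep _) ?_ (card_coordLevel S)
  rintro _ j a ⟨i, c⟩ rfl
  rw [arrowElt_smul_colRep]
  refine sum_mem fun r _ => ?_
  by_cases h0 : arrowMat (lowPoint θ) a r c = 0
  · rw [h0, mul_zero, zero_smul]; exact zero_mem _
  · exact Submodule.smul_mem _ _
      (Submodule.subset_span ⟨⟨j, r⟩, ⟨arrowMat_lowPoint_ne_zero a h0, rfl⟩, rfl⟩)

variable [∀ i j : V, Fintype (i ⟶ j)]

/-- The span is, up to currying coordinates, the column space of a matrix whose entries are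
polynomials in `θ`, so the condition is a lower bound on a rank. -/
theorem isOpen_le_finrank_arrowSpan (r l : ℕ) (j : V) :
    IsOpen[zariski (ConjIndex S) K] {θ | r ≤ Module.finrank K
      (arrowSpan K L (colRep (conjPoint θ) (conjMat θ))
        (fun t => coordLevel S t.1 t.2) l j)} := by
  classical
  let A : (ConjIndex S → K) → Matrix (Σ i, Fin (dimVec S i))
      ((Σ i, (i ⟶ j)) × {t : Σ i, Fin (dimVec S i) // l ≤ coordLevel S t.1 t.2}) K :=
    fun θ => Matrix.of fun s p =>
      (Pi.single j ((arrowMat (conjCoord θ) p.1.2).mulVec (colRep (conjPoint θ) (conjMat θ) p.2.1 p.1.1)) :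
        (i : V) → Fin (dimVec S i) → K) s.1 s.2
  have hA : ∀ s p, IsPoly fun θ => A θ s p := fun s p => by
    refine isPoly_single (fun r => ?_) s.1 s.2
    simp only [Matrix.mulVec, dotProduct]
    refine IsPoly.sum _ fun k => (isPoly_conjCoord _).mul ?_
    exact isPoly_single (f := fun θ => (conjMat θ p.2.1.1).col p.2.1.2)
      (fun r => isPoly_conjMat _ _ _) p.1.1 k
  convert isOpen_le_rank hA r using 3 with θ
  have hcol : (fun p : (Σ i, (i ⟶ j)) × {t : Σ i, Fin (dimVec S i) // l ≤ coordLevel S t.1 t.2} =>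
      arrowElt K L p.1.2 • colRep (conjPoint θ) (conjMat θ) p.2) =
      LinearEquiv.piCurry K (fun i (_ : Fin (dimVec S i)) => K) ∘ (A θ).col := by
    funext p
    rw [arrowElt_smul_rep]
    rfl
  rw [Matrix.rank_eq_finrank_span_cols,
    ← LinearEquiv.finrank_map_eq (LinearEquiv.piCurry K fun i (_ : Fin (dimVec S i)) => K),
    Submodule.map_span, ← Set.range_comp]
  unfold arrowSpan
  rw [hcol]
  rfl

/-- On the locus of invertible matrices the columns form a basis on which arrows raise the level.
There the layering amounts to finitely many lower bounds on ranks, the upper bounds being automatic.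
-/
theorem isOpen_conj :
    IsOpen[zariski (ConjIndex S) K]
      {θ | (∀ i, (conjMat θ i).det ≠ 0) ∧ conjPoint θ ∈ RepS K S} := by
  have h : {θ : ConjIndex S → K | (∀ i, (conjMat θ i).det ≠ 0) ∧ conjPoint θ ∈ RepS K S} =
      (⋂ i, {θ | (conjMat θ i).det ≠ 0}) ∩ ⋂ l : Fin (L + 1), ⋂ j, {θ | tail S (l + 1) j ≤
        Module.finrank K (arrowSpan K L (colRep (conjPoint θ) (conjMat θ))
          (fun t => coordLevel S t.1 t.2) l j)} := by
    ext θ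
    simp only [Set.mem_ofPred_eq, Set.mem_inter_iff, Set.mem_iInter]
    refine and_congr_right fun hθ => (conjPoint_mem_iff hθ).trans ?_
    exact ⟨fun h l => h l (Nat.lt_succ_iff.1 l.2), fun h l hl => h ⟨l, Nat.lt_succ_of_le hl⟩⟩
  rw [h]
  let _ := zariski (ConjIndex S) K
  refine IsOpen.inter (isOpen_iInter_of_finite fun i => ?_)
    (isOpen_iInter_of_finite fun l => isOpen_iInter_of_finite fun j => ?_)
  · exact (IsPoly.det (isPoly_conjMat i)).isOpen_ne_zero
  · exact isOpen_le_finrank_arrowSpan _ _ _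

end Conjugation

/-! ### Adapted bases and irreducibility -/

section AdaptedBasis

theorem exists_span_sup_eq {K M : Type*} [Field K] [AddCommGroup M] [Module K M]
    [Module.Finite K M] {W W' : Submodule K M} (hW : W ≤ W') {n : ℕ}
    (hn : Module.finrank K W' = n + Module.finrank K W) :
    ∃ f : Fin n → M, Submodule.span K (Set.range f) ⊔ W = W' := by
  obtain ⟨C, hC⟩ := Submodule.exists_isCompl W
  have hsup : (C ⊓ W') ⊔ W = W' := by
    rw [sup_comm, ← sup_inf_assoc_of_le C hW, hC.sup_eq_top, top_inf_eq]
  have hinf : (C ⊓ W') ⊓ W = ⊥ :=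
    eq_bot_iff.2 fun m hm => by
      rw [← hC.inf_eq_bot]
      exact ⟨hm.2, hm.1.1⟩
  have hd := Submodule.finrank_sup_add_finrank_inf_eq (C ⊓ W') W
  rw [hsup, hinf, finrank_bot] at hd
  let b := Module.finBasisOfFinrankEq K ↥(C ⊓ W') (n := n) (by omega)
  refine ⟨fun k => (b k).1, ?_⟩
  have hr : Set.range (fun k => (b k).1) = (C ⊓ W').subtype '' Set.range b := by
    rw [← Set.range_comp]; rfl
  rw [hr, ← Submodule.map_span, b.span_eq, Submodule.map_top, Submodule.range_subtype, hsup]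

variable {K : Type u} [Field K] {V : Type v} [Quiver.{w} V] [Fintype V] {L : ℕ}
  {S : Fin (L + 1) → V → ℕ}

/-- At each vertex, vectors spanning a complement of `e_i J ^ (l + 1) M` in `e_i J ^ l M` are
collected over all `l`. There are `S l i` of them, which matches the block of coordinates of level
`l`. -/
theorem exists_adapted {y : RepVar K L (dimVec S)} (hy : y ∈ RepS K S) :
    ∃ g : (i : V) → Matrix (Fin (dimVec S i)) (Fin (dimVec S i)) K, (∀ i, (g i).det ≠ 0) ∧
      ∀ t, colRep y g t ∈
        vertexRad K V L (RepModule y) (coordLevel S t.1 t.2) t.1 := by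
  classical
  have hfin := hasLayering_iff.1 (show HasLayering K S (RepModule y) from hy)
  have hex : ∀ (l : Fin (L + 1)) (i : V), ∃ f : Fin (S l i) → RepModule y,
      Submodule.span K (Set.range f) ⊔ vertexRad K V L (RepModule y) (l + 1) i =
        vertexRad K V L (RepModule y) l i := fun l i =>
    exists_span_sup_eq (vertexRad_antitone i (Nat.le_succ l)) (by rw [hfin, hfin, tail_eq_add])
  choose f hf using hex
  let b : (i : V) → Fin (dimVec S i) → RepModule y := fun i c =>
    f ((finSigmaFinEquiv (n := fun l => S l i)).symm c).1 i (finSigmaFinEquiv.symm c).2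
  have hbmem : ∀ i c, b i c ∈ vertexRad K V L (RepModule y) (coordLevel S i c) i := fun i c => by
    rw [coordLevel, ← hf]
    exact Submodule.mem_sup_left (Submodule.subset_span ⟨_, rfl⟩)
  -- Descending induction on `l`: the vectors of block `l` generate `e_i J ^ l M` modulo the next
  -- step, and the filtration ends in zero. The case `l = 0` shows that the square matrices have
  -- independent columns.
  have hspan : ∀ l i, vertexRad K V L (RepModule y) l i ≤
      Submodule.span K (Set.range (b i)) := by
    intro l i
    rcases Nat.lt_or_ge L l with hl | hl
    · rw [vertexRad_eq_bot hl]; exact bot_le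
    · have step : ∀ k : Fin (L + 1), vertexRad K V L (RepModule y) (k + 1) i ≤
          Submodule.span K (Set.range (b i)) → vertexRad K V L (RepModule y) k i ≤
          Submodule.span K (Set.range (b i)) := fun k hk => by
        rw [← hf]
        refine sup_le (Submodule.span_le.2 ?_) hk
        rintro _ ⟨s, rfl⟩
        refine Submodule.subset_span ⟨finSigmaFinEquiv ⟨k, s⟩, ?_⟩
        simp only [b]
        rw [Equiv.symm_apply_apply]
      induction hl using Nat.decreasingInduction with
      | of_succ k hk ih => exact step ⟨k, Nat.lt_succ_of_lt hk⟩ ih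
      | self =>
        refine step ⟨L, Nat.lt_succ_self L⟩ ?_
        rw [vertexRad_eq_bot (Nat.lt_succ_self L)]; exact bot_le
  have hbi : ∀ i c, b i c = (Pi.single i (b i c i) : (i : V) → Fin (dimVec S i) → K) :=
    fun i c => by
      rw [← idem_smul_rep]
      exact ((hbmem i c).2).symm
  refine ⟨fun i => Matrix.of fun r c => b i c i r, fun i => ?_, ?_⟩
  · have htop : ⊤ ≤ Submodule.span K (Set.range fun c => b i c i) := by
      intro m _
      let m' : RepModule y := (Pi.single i m : (i : V) → Fin (dimVec S i) → K)
      have hm' : m' i = m :=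
        Pi.single_eq_same (M := fun i => Fin (dimVec S i) → K) i m
      have h1 : m' ∈ vertexRad K V L (RepModule y) 0 i := by
        refine mem_vertexRad_zero.2 ?_
        rw [idem_smul_rep, hm']
      have h2 : m ∈ Submodule.map (LinearMap.proj i :
          ((i : V) → Fin (dimVec S i) → K) →ₗ[K] Fin (dimVec S i) → K)
          (Submodule.span K (Set.range (b i))) := ⟨m', hspan 0 i h1, hm'⟩
      have h3 := Submodule.map_span (LinearMap.proj i :
        ((i : V) → Fin (dimVec S i) → K) →ₗ[K] Fin (dimVec S i) → K) (Set.range (b i))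
      have h4 := h3.le h2
      have h5 : Set.range (fun c => b i c i) = (LinearMap.proj i :
          ((i : V) → Fin (dimVec S i) → K) →ₗ[K] Fin (dimVec S i) → K) '' Set.range (b i) :=
        Set.range_comp (fun m : (i : V) → Fin (dimVec S i) → K => m i) (b i)
      rw [h5]
      exact h4
    have hli := linearIndependent_of_top_le_span_of_card_eq_finrank htop (by simp)
    exact ((Matrix.isUnit_iff_isUnit_det _).1
      (Matrix.linearIndependent_cols_iff_isUnit.1 hli)).ne_zero
  · rintro ⟨i, c⟩
    convert hbmem i c using 1
    rw [hbi i c]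
    simp only [colRep, colVec]
    congr!

/-- In an adapted basis the matrices of the arrows strictly raise the level, because an arrow maps
`J ^ l M` into `J ^ (l + 1) M`. Hence `y` is a conjugate of a level-raising representation. -/
theorem exists_conjPoint_eq {y : RepVar K L (dimVec S)} (hy : y ∈ RepS K S) :
    ∃ θ : ConjIndex S → K, (∀ i, (conjMat θ i).det ≠ 0) ∧ conjPoint θ = y := by
  classical
  obtain ⟨g, hg, hmem⟩ := exists_adapted hy
  have hu : ∀ i, IsUnit (g i).det := fun i => (hg i).isUnit
  let X : (i j : V) → (i ⟶ j) → Matrix (Fin (dimVec S j)) (Fin (dimVec S i)) K := fun i j a =>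
    (g j)⁻¹ * arrowMat y.1 a * g i
  have hX : ∀ (i j : V) (a : i ⟶ j) r c, ¬ coordLevel S i c < coordLevel S j r →
      X i j a r c = 0 := by
    intro i j a r c hlt
    have h1 := arrowElt_smul_mem a (hmem ⟨i, c⟩).1
    rw [HasLayering.vertexRad_eq (b := (colRep y g)) (vert := fun t => t.1)
      (lev := fun t => coordLevel S t.1 t.2) hy (linearIndependent_colRep hg) hmem
      (card_coordLevel S)] at h1
    -- The functional that reads off the coefficient of the `r`-th adapted basis vector at `j`; it
    -- kills all vectors of level above that of `r`.
    let φ : RepModule y →ₗ[K] K := (LinearMap.proj r ∘ₗ Matrix.mulVecLin (g j)⁻¹ ∘ₗ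
      LinearMap.proj j : ((i : V) → Fin (dimVec S i) → K) →ₗ[K] K)
    have h2 : levelSpan K (colRep y g) (fun t => coordLevel S t.1 t.2)
        (fun t => t.1) (coordLevel S i c + 1) j ≤ LinearMap.ker φ := by
      refine Submodule.span_le.2 ?_
      rintro _ ⟨⟨k, s⟩, ⟨hs, hk⟩, rfl⟩
      dsimp only at hs hk
      subst hk
      change ((g k)⁻¹.mulVec (colRep y g ⟨k, s⟩ k)) r = 0
      rw [colRep_apply, ← Matrix.mulVec_single_one, Matrix.mulVec_mulVec, Matrix.nonsing_inv_mul _ (hu k),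
        Matrix.one_mulVec]
      refine Pi.single_eq_of_ne ?_ _
      rintro rfl
      omega
    have h4 := h2 h1
    rw [LinearMap.mem_ker, arrowElt_smul_rep] at h4
    change ((g j)⁻¹.mulVec ((Pi.single j ((arrowMat y.1 a).mulVec (colRep y g ⟨i, c⟩ i)) :
      (i : V) → Fin (dimVec S i) → K) j)) r = 0 at h4
    rw [Pi.single_eq_same, colRep_apply, ← Matrix.mulVec_single_one, Matrix.mulVec_mulVec,
      Matrix.mulVec_mulVec, Matrix.mulVec_single_one] at h4
    exact h4
  -- The factor `(g i).det⁻¹` compensates for the adjugate standing in for the inverse.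
  let θ : ConjIndex S → K := fun c =>
    match c with
    | .inl ⟨i, r, c⟩ => g i r c
    | .inr ⟨i, j, a, r, c⟩ => (g i).det⁻¹ * X i j a r c
  have hθg : conjMat θ = g := rfl
  refine ⟨θ, hθg ▸ hg, Subtype.ext ?_⟩
  have hlow : ∀ {i j : V} (a : i ⟶ j), arrowMat (lowPoint θ) a = (g i).det⁻¹ • X i j a := by
    intro i j a
    ext r c
    change (if _ then _ else _) = _
    split_ifs with h
    · rfl
    · rw [Matrix.smul_apply, hX i j a r c h, smul_zero]
  funext ⟨i, j, a, r, c⟩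
  have : arrowMat (conjCoord θ) a = arrowMat y.1 a := by
    rw [arrowMat_conjCoord, hlow, hθg]
    calc _ = (g i).det⁻¹ • ((g j * (g j)⁻¹) * arrowMat y.1 a * (g i * (g i).adjugate)) := by
          simp only [X, Matrix.mul_smul, Matrix.smul_mul, Matrix.mul_assoc]
      _ = _ := by
        rw [Matrix.mul_nonsing_inv _ (hu j), Matrix.mul_adjugate, Matrix.one_mul, Matrix.mul_smul,
          Matrix.mul_one, smul_smul, inv_mul_cancel₀ (hg i), one_smul]
  exact congrFun (congrFun this r) c

variable [∀ i j : V, Fintype (i ⟶ j)]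

variable (K S) in
-- An open subset of an affine space over an infinite field is preirreducible, and so is its
-- continuous image.
theorem isPreirreducible_repS [Infinite K] : IsPreirreducible (RepS K S) := by
  let _ := zariski (ConjIndex S) K
  have h : RepS K S = conjPoint ''
      {θ : ConjIndex S → K | (∀ i, (conjMat θ i).det ≠ 0) ∧ conjPoint θ ∈ RepS K S} := by
    ext y
    constructor
    · intro hy
      obtain ⟨θ, hθ, rfl⟩ := exists_conjPoint_eq hy
      exact ⟨θ, ⟨hθ, hy⟩, rfl⟩
    · rintro ⟨θ, hθ, rfl⟩
      exact hθ.2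
  rw [h]
  exact ((isPreirreducible_univ_zariski K (ConjIndex S)).open_subset isOpen_conj
    (Set.subset_univ _)).image _ continuous_conjPoint.continuousOn

end AdaptedBasis

/-! ### Existence of skeleta -/

section Existence

variable {K : Type u} [Field K] {V : Type v} [Quiver.{w} V] [Fintype V]
  [∀ i j : V, Fintype (i ⟶ j)] {L : ℕ} {S : Fin (L + 1) → V → ℕ}

/-- Lifts of bases of the vertex parts of layer `l`, moved by the arrows ending in `j`, generate the
part of the next layer at `j`. -/
theorem HasLayering.le_sum {M : Type*} [AddCommGroup M] [Module K M] [Module (Lam K V L) M]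
    [IsScalarTower K (Lam K V L) M] [Module.Finite K M] (h : HasLayering K S M)
    (l m : Fin (L + 1)) (hlm : (m : ℕ) = l + 1) (j : V) :
    S m j ≤ ∑ i, S l i * Fintype.card (i ⟶ j) := by
  have hfin := hasLayering_iff.1 h
  have hex : ∀ i : V, ∃ f : Fin (S l i) → M,
      Submodule.span K (Set.range f) ⊔ vertexRad K V L M (l + 1) i =
        vertexRad K V L M l i := fun i =>
    exists_span_sup_eq (vertexRad_antitone i (Nat.le_succ l)) (by rw [hfin, hfin, tail_eq_add])
  choose f hf using hex
  let w : (Σ i, Fin (S l i) × (i ⟶ j)) → M := fun t => arrowElt K L t.2.2 • f t.1 t.2.1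
  have hle : vertexRad K V L M (l + 1) j ≤
      Submodule.span K (Set.range w) ⊔ vertexRad K V L M (l + 1 + 1) j := by
    rw [vertexRad_succ]
    refine iSup_le fun a => ?_
    rw [← hf, Submodule.map_sup, Submodule.map_span]
    refine sup_le_sup (Submodule.span_le.2 ?_) ?_
    · rintro _ ⟨_, ⟨k, rfl⟩, rfl⟩
      exact Submodule.subset_span ⟨⟨a.1, k, a.2⟩, rfl⟩
    · rintro _ ⟨m, hm, rfl⟩
      exact arrowElt_smul_mem a.2 hm.1
  have h1 := (Submodule.finrank_mono hle).trans
    (Submodule.finrank_add_le_finrank_add_finrank _ _)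
  have h2 := finrank_range_le_card (R := K) w
  rw [hfin, hfin, ← hlm, tail_eq_add] at h1
  simp only [Fintype.card_sigma, Fintype.card_prod, Fintype.card_fin] at h2
  rw [Set.finrank] at h2
  omega

omit [∀ i j : V, Fintype (i ⟶ j)] in
open Classical in
theorem exists_skeleton_zero : ∃ σ : Finset (PPath S), (∀ u ∈ σ, u.path.length = 0) ∧
    ∀ i, (σ.filter fun u => u.target = i).card = S 0 i := by
  let F : Top S → PPath S := fun r => ⟨r, r.1, Quiver.Path.nil⟩
  refine ⟨Finset.univ.image F, fun u hu => ?_, fun i => ?_⟩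
  · obtain ⟨r, -, rfl⟩ := Finset.mem_image.1 hu
    rfl
  · have h : (Finset.univ.image F).filter (fun u => u.target = i) =
        (Finset.univ : Finset (Fin (S 0 i))).image fun k => F ⟨i, k⟩ := by
      ext u
      simp only [Finset.mem_filter, Finset.mem_image, Finset.mem_univ, true_and]
      constructor
      · rintro ⟨⟨⟨j, k⟩, rfl⟩, rfl⟩
        exact ⟨k, rfl⟩
      · rintro ⟨k, rfl⟩
        exact ⟨⟨_, rfl⟩, rfl⟩
    rw [h, Finset.card_image_of_injective, Finset.card_univ, Fintype.card_fin]
    intro k k' hk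
    simpa [F] using congrArg PPath.root hk

open Classical in
-- Distinct pairs of a path and an arrow give distinct extensions, so the number of one-arrow
-- extensions ending in `j` is the right-hand side of `hst`. Any subset of the required size will
-- do.
theorem exists_skeleton_layer (σ : Finset (PPath S)) {l : ℕ}
    {s t : V → ℕ} (hs : ∀ i, (σ.filter fun u => u.path.length = l ∧ u.target = i).card = s i)
    (hst : ∀ j, t j ≤ ∑ i, s i * Fintype.card (i ⟶ j)) :
    ∃ τ : Finset (PPath S), (∀ u ∈ τ, u.path.length = l + 1) ∧
      (∀ (r : Top S) (i j : V) (p : Quiver.Path r.1 i) (a : i ⟶ j),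
        (⟨r, j, p.cons a⟩ : PPath S) ∈ τ → (⟨r, i, p⟩ : PPath S) ∈ σ) ∧
      ∀ j, (τ.filter fun u => u.target = j).card = t j := by
  let C : V → Finset (PPath S) := fun j =>
    ((σ.filter fun u => u.path.length = l).sigma
      fun u => (Finset.univ : Finset (u.target ⟶ j))).image
        fun z => ⟨z.1.root, j, z.1.path.cons z.2⟩
  have hC : ∀ j, (C j).card = ∑ i, s i * Fintype.card (i ⟶ j) := fun j => by
    rw [Finset.card_image_of_injective, Finset.card_sigma,
      ← Finset.sum_fiberwise_of_maps_to (t := Finset.univ) (g := PPath.target)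
        fun _ _ => Finset.mem_univ _]
    · refine Finset.sum_congr rfl fun i _ => ?_
      rw [Finset.filter_filter, ← hs, ← smul_eq_mul, ← Finset.sum_const]
      refine Finset.sum_congr rfl fun u hu => ?_
      obtain ⟨-, -, rfl⟩ := Finset.mem_filter.1 hu
      rfl
    · rintro ⟨⟨r, i, p⟩, a⟩ ⟨⟨r', i', p'⟩, a'⟩ h
      simp only [PPath.mk.injEq, true_and] at h
      obtain ⟨rfl, h⟩ := h
      have h := eq_of_heq h
      obtain rfl := Quiver.Path.obj_eq_of_cons_eq_cons h
      obtain rfl := eq_of_heq (Quiver.Path.heq_of_cons_eq_cons h)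
      obtain rfl := eq_of_heq (Quiver.Path.hom_heq_of_cons_eq_cons h)
      rfl
  have hex : ∀ j, ∃ τ ⊆ C j, τ.card = t j := fun j =>
    Finset.exists_subset_card_eq ((hst j).trans (hC j).ge)
  choose τ hτ hcard using hex
  have htarget : ∀ j, ∀ u ∈ τ j, u.target = j := fun j u hu => by
    obtain ⟨z, -, rfl⟩ := Finset.mem_image.1 (hτ j hu)
    rfl
  refine ⟨Finset.univ.biUnion τ, fun u hu => ?_, fun r i j p a h => ?_, fun j => ?_⟩
  · obtain ⟨j, -, hu⟩ := Finset.mem_biUnion.1 hu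
    obtain ⟨z, hz, rfl⟩ := Finset.mem_image.1 (hτ j hu)
    rw [Quiver.Path.length_cons, (Finset.mem_filter.1 (Finset.mem_sigma.1 hz).1).2]
  · obtain ⟨j', -, hu⟩ := Finset.mem_biUnion.1 h
    obtain ⟨⟨⟨r', i', p'⟩, a'⟩, hz, h⟩ := Finset.mem_image.1 (hτ j' hu)
    simp only [PPath.mk.injEq] at h
    obtain ⟨rfl, rfl, h⟩ := h
    have h := eq_of_heq h
    obtain rfl := Quiver.Path.obj_eq_of_cons_eq_cons h
    obtain rfl := eq_of_heq (Quiver.Path.heq_of_cons_eq_cons h)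
    exact (Finset.mem_filter.1 (Finset.mem_sigma.1 hz).1).1
  · rw [← hcard j]
    congr 1
    ext u
    simp only [Finset.mem_filter, Finset.mem_biUnion, Finset.mem_univ, true_and]
    constructor
    · rintro ⟨⟨j', hj'⟩, rfl⟩
      rwa [htarget j' u hj']
    · exact fun hu => ⟨⟨j, hu⟩, htarget j u hu⟩

theorem exists_isSkeleton
    (hS : ∀ (l m : Fin (L + 1)), (m : ℕ) = l + 1 → ∀ j,
      S m j ≤ ∑ i, S l i * Fintype.card (i ⟶ j)) :
    ∃ σ : Finset (PPath S), IsSkeleton σ := by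
  classical
  -- Partial skeleta, correct up to length `m`, are extended one layer at a time.
  suffices h : ∀ m ≤ L, ∃ σ : Finset (PPath S), (∀ u ∈ σ, u.path.length ≤ m) ∧
      (∀ (r : Top S) (i j : V) (p : Quiver.Path r.1 i) (q : Quiver.Path i j),
        (⟨r, j, p.comp q⟩ : PPath S) ∈ σ → (⟨r, i, p⟩ : PPath S) ∈ σ) ∧
      ∀ (l : Fin (L + 1)) (i : V), (l : ℕ) ≤ m →
        (σ.filter fun u => u.path.length = (l : ℕ) ∧ u.target = i).card = S l i by
    obtain ⟨σ, h1, h2, h3⟩ := h L le_rfl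
    refine ⟨σ, h1, h2, fun l i => ?_⟩
    rw [← h3 l i (Nat.lt_succ_iff.1 l.2)]
  intro m hm
  induction m with
  | zero =>
    obtain ⟨σ, h1, h2⟩ := exists_skeleton_zero (S := S)
    refine ⟨σ, fun u hu => (h1 u hu).le, fun r i j p q h => ?_, fun l i hl => ?_⟩
    · have h0 := h1 _ h
      cases q with
      | nil => exact h
      | cons q a => simp at h0
    · obtain rfl : l = 0 := Fin.ext (Nat.le_zero.1 hl)
      rw [← h2]
      congr 1
      ext u
      simp only [Finset.mem_filter]
      exact ⟨fun h => ⟨h.1, h.2.2⟩, fun h => ⟨h.1, h1 u h.1, h.2⟩⟩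
  | succ m ih =>
    obtain ⟨σ, h1, h2, h3⟩ := ih (by omega)
    obtain ⟨τ, k1, k2, k3⟩ := exists_skeleton_layer σ
      (fun i => h3 ⟨m, by omega⟩ i le_rfl)
      (hS ⟨m, by omega⟩ ⟨m + 1, by omega⟩ rfl)
    refine ⟨σ ∪ τ, fun u hu => ?_, fun r i j p q h => ?_, fun l i hl => ?_⟩
    · rcases Finset.mem_union.1 hu with hu | hu
      · exact (h1 u hu).trans (Nat.le_succ m)
      · exact (k1 u hu).le
    · rcases Finset.mem_union.1 h with h | h
      · exact Finset.mem_union_left _ (h2 r i j p q h)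
      · cases q with
        | nil => exact Finset.mem_union_right _ h
        | cons q a => exact Finset.mem_union_left _ (h2 r i _ p q (k2 r _ j _ a h))
    · rcases Nat.lt_or_ge m l with hml | hml
      · obtain rfl : l = ⟨m + 1, Nat.lt_succ_of_le hm⟩ := Fin.ext (by dsimp only; omega)
        rw [← k3 i]
        congr 1
        ext u
        simp only [Finset.mem_filter, Finset.mem_union]
        constructor
        · rintro ⟨hu | hu, h4, h5⟩
          · have := h1 u hu
            omega
          · exact ⟨hu, h5⟩
        · rintro ⟨hu, h5⟩
          exact ⟨Or.inr hu, k1 u hu, h5⟩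
      · rw [← h3 l i hml]
        congr 1
        ext u
        simp only [Finset.mem_filter, Finset.mem_union]
        constructor
        · rintro ⟨hu | hu, h4, h5⟩
          · exact ⟨hu, h4, h5⟩
          · have := k1 u hu
            omega
        · rintro ⟨hu, h⟩
          exact ⟨Or.inl hu, h⟩

theorem Realizable.exists_isSkeleton (h : Realizable K S) :
    ∃ σ : Finset (PPath S), IsSkeleton σ := by
  obtain ⟨M, _, _, _, _, _, hM⟩ := h
  exact TruncPath.exists_isSkeleton fun l m hlm j => hM.le_sum l m hlm j

end Existence

/-! ### Semicontinuity of the dimension of endomorphism rings -/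

section EndDim

open scoped Classical

variable {K : Type u} [Field K] {V : Type v} [Quiver.{w} V] {L : ℕ} {d : V → ℕ}

instance [Finite V] [∀ i j : V, Finite (i ⟶ j)] : Finite (Gen V) := by
  refine Finite.of_surjective (fun z : V ⊕ (Σ (i : V) (j : V), (i ⟶ j)) =>
    match z with
    | .inl i => Gen.vertex i
    | .inr z => Gen.arrow z.2.2) ?_
  rintro (i | a)
  · exact ⟨.inl i, rfl⟩
  · exact ⟨.inr ⟨_, _, a⟩, rfl⟩

/-- The matrix by which a generator acts on `⨁ i, K ^ (d i)`. -/
def genMat (x : Coord d → K) (g : Gen V) : Matrix (Σ i, Fin (d i)) (Σ i, Fin (d i)) K :=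
  Matrix.of fun s t => genAct x g (Pi.single t.1 (Pi.single t.2 1)) s.1 s.2

theorem isPoly_genMat (g : Gen V) (s t : Σ i, Fin (d i)) :
    IsPoly fun x : Coord d → K => genMat x g s t := by
  cases g with
  | vertex i => exact IsPoly.const _
  | @arrow i j a =>
    simp only [genMat, Matrix.of_apply, genAct]
    refine isPoly_single (f := fun x => (arrowMat x a).mulVec
      ((Pi.single t.1 (Pi.single t.2 1) : (i : V) → Fin (d i) → K) i)) (fun r => ?_) s.1 s.2
    simp only [Matrix.mulVec, dotProduct]
    exact IsPoly.sum _ fun k => (IsPoly.coord (ι := Coord d) ⟨i, j, a, r, k⟩).mul (IsPoly.const _)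

/-- The matrix of the system of linear equations which says that a matrix commutes with
all generators. -/
def commMat (x : Coord d → K) :
    Matrix (Gen V × (Σ i, Fin (d i)) × (Σ i, Fin (d i)))
      ((Σ i, Fin (d i)) × (Σ i, Fin (d i))) K :=
  Matrix.of fun e z => (if e.2.1 = z.1 then genMat x e.1 z.2 e.2.2 else 0) -
    if z.2 = e.2.2 then genMat x e.1 e.2.1 z.1 else 0

theorem isPoly_commMat (e : Gen V × (Σ i, Fin (d i)) × (Σ i, Fin (d i)))
    (z : (Σ i, Fin (d i)) × (Σ i, Fin (d i))) :
    IsPoly fun x : Coord d → K => commMat x e z :=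
  (IsPoly.ite (isPoly_genMat _ _ _) (IsPoly.const 0)).sub
    (IsPoly.ite (isPoly_genMat _ _ _) (IsPoly.const 0))

variable [Fintype V]

theorem commMat_mulVec (x : Coord d → K) (X : (Σ i, Fin (d i)) × (Σ i, Fin (d i)) → K)
    (g : Gen V) (s t : Σ i, Fin (d i)) : (commMat x).mulVec X (g, s, t) =
      (Matrix.of (Function.curry X) * genMat x g - genMat x g * Matrix.of (Function.curry X)) s t := by
  simp only [Matrix.mulVec, dotProduct, commMat, Matrix.of_apply, sub_mul,
    Finset.sum_sub_distrib, Matrix.sub_apply, Matrix.mul_apply, Function.curry_apply,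
    Fintype.sum_prod_type, ite_mul, zero_mul]
  congr 1
  · rw [Finset.sum_eq_single s]
    · simp [mul_comm]
    · intro r _ hr; simp [hr.symm]
    · simp
  · refine Finset.sum_congr rfl fun r _ => ?_
    simp

/-- The standard basis of the module `M_y`. -/
def repBasis (y : RepVar K L d) : Module.Basis (Σ i, Fin (d i)) K (RepModule y) :=
  Pi.basis fun i => Pi.basisFun K (Fin (d i))

theorem toMatrix_generator (y : RepVar K L d) (g : Gen V) :
    LinearMap.toMatrix (repBasis y) (repBasis y)
      (Algebra.lsmul K K (RepModule y) (Lam.mk K L (FreeAlgebra.ι K g))) = genMat y.1 g := by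
  ext s t
  rw [LinearMap.toMatrix_apply]
  have h1 : repBasis y t = (Pi.single t.1 (Pi.single t.2 1) : (i : V) → Fin (d i) → K) := by
    refine (Pi.basis_apply _ t).trans ?_
    rw [Pi.basisFun_apply]
  have h2 : Algebra.lsmul K K (RepModule y) (Lam.mk K L (FreeAlgebra.ι K g)) (repBasis y t) =
      genAct y.1 g (repBasis y t) := by
    change action y (Lam.mk K L _) _ = _
    rw [action_mk, FreeAlgebra.lift_ι_apply]
  rw [h2, h1]
  change genAct y.1 g _ s.1 s.2 = genAct y.1 g _ s.1 s.2
  congr!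

theorem map_smul_of_generators {M N : Type*} [AddCommGroup M] [Module K M]
    [Module (Lam K V L) M] [IsScalarTower K (Lam K V L) M] [AddCommGroup N] [Module K N]
    [Module (Lam K V L) N] [IsScalarTower K (Lam K V L) N] (f : M →ₗ[K] N)
    (hf : ∀ (g : Gen V) (m : M), f (Lam.mk K L (FreeAlgebra.ι K g) • m) =
      Lam.mk K L (FreeAlgebra.ι K g) • f m) (x : Lam K V L) (m : M) : f (x • m) = x • f m := by
  obtain ⟨a, rfl⟩ := Lam.mk_surjective x
  induction a using FreeAlgebra.induction generalizing m with
  | grade0 r => rw [AlgHom.commutes, algebraMap_smul, algebraMap_smul, map_smul]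
  | grade1 g => exact hf g m
  | mul a b ha hb => rw [map_mul, mul_smul, mul_smul, ha, hb]
  | add a b ha hb => rw [map_add, add_smul, add_smul, map_add, ha, hb]

/-- The matrix of an endomorphism of `M_y`. -/
def endMatrix (y : RepVar K L d) : Module.End (Lam K V L) (RepModule y) →ₗ[K]
    ((Σ i, Fin (d i)) × (Σ i, Fin (d i)) → K) where
  toFun φ z := LinearMap.toMatrix (repBasis y) (repBasis y) (φ.restrictScalars K) z.1 z.2
  map_add' φ ψ := by
    funext z
    rw [LinearMap.restrictScalars_add, map_add]
    rfl
  map_smul' c φ := by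
    funext z
    rw [LinearMap.restrictScalars_smul, map_smul]
    rfl

theorem endMatrix_injective (y : RepVar K L d) : Function.Injective (endMatrix y) := by
  intro φ ψ h
  have h1 : LinearMap.toMatrix (repBasis y) (repBasis y) (φ.restrictScalars K) =
      LinearMap.toMatrix (repBasis y) (repBasis y) (ψ.restrictScalars K) := by
    ext s t
    exact congrFun h (s, t)
  exact LinearMap.restrictScalars_injective K ((LinearMap.toMatrix _ _).injective h1)

/-- A `K`-linear map is `Λ`-linear once it commutes with the generators, so the endomorphisms form
the kernel of a matrix with polynomial entries in `y`. -/
theorem range_endMatrix (y : RepVar K L d) :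
    LinearMap.range (endMatrix y) = LinearMap.ker (commMat y.1).mulVecLin := by
  ext X
  rw [LinearMap.mem_ker, Matrix.mulVecLin_apply]
  have hiff : (commMat y.1).mulVec X = 0 ↔ ∀ g, Matrix.of (Function.curry X) * genMat y.1 g =
      genMat y.1 g * Matrix.of (Function.curry X) := by
    constructor
    · intro h g
      rw [← sub_eq_zero]
      ext s t
      rw [← commMat_mulVec, h]
      rfl
    · intro h
      funext ⟨g, s, t⟩
      rw [commMat_mulVec, h, sub_self]
      rfl
  rw [hiff]
  constructor
  · rintro ⟨φ, rfl⟩ g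
    change LinearMap.toMatrix (repBasis y) (repBasis y) (φ.restrictScalars K) * _ =
      _ * LinearMap.toMatrix (repBasis y) (repBasis y) (φ.restrictScalars K)
    rw [← toMatrix_generator, ← LinearMap.toMatrix_comp, ← LinearMap.toMatrix_comp]
    congr 1
    ext m
    simp
  · intro h
    let f := Matrix.toLin (repBasis y) (repBasis y) (Matrix.of (Function.curry X))
    have hf : LinearMap.toMatrix (repBasis y) (repBasis y) f = Matrix.of (Function.curry X) :=
      LinearMap.toMatrix_toLin _ _ _
    refine ⟨{ f with map_smul' := map_smul_of_generators f fun g m => ?_ }, ?_⟩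
    · have h1 := h g
      rw [← hf, ← toMatrix_generator, ← LinearMap.toMatrix_comp, ← LinearMap.toMatrix_comp] at h1
      exact LinearMap.congr_fun ((LinearMap.toMatrix _ _).injective h1) m
    · funext z
      exact congrFun (congrFun hf z.1) z.2

theorem rank_commMat_add (y : RepVar K L d) :
    (commMat y.1).rank + Module.finrank K (Module.End (Lam K V L) (RepModule y)) =
      Fintype.card ((Σ i, Fin (d i)) × (Σ i, Fin (d i))) := by
  have h := LinearMap.finrank_range_add_finrank_ker (commMat y.1).mulVecLin
  rw [← range_endMatrix, LinearMap.finrank_range_of_inj (endMatrix_injective y),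
    Module.finrank_fintype_fun_eq_card] at h
  exact h

/-- Upper semicontinuity: an upper bound on the nullity is a lower bound on the rank of `commMat`.
-/
theorem isOpen_finrank_end_le [∀ i j : V, Fintype (i ⟶ j)] (D : ℕ) :
    IsOpen {y : RepVar K L d | Module.finrank K (Module.End (Lam K V L) (RepModule y)) ≤ D} := by
  have h : {y : RepVar K L d | Module.finrank K (Module.End (Lam K V L) (RepModule y)) ≤ D} =
      Subtype.val ⁻¹' {x : Coord d → K |
        Fintype.card ((Σ i, Fin (d i)) × (Σ i, Fin (d i))) - D ≤ (commMat x).rank} := by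
    ext y
    have h1 := rank_commMat_add y
    change _ ≤ D ↔ _ - D ≤ (commMat y.1).rank
    omega
  rw [h]
  let _ := zariski (Coord d) K
  exact (isOpen_le_rank isPoly_commMat _).preimage continuous_induced_dom

end EndDim

/-! ### Modules with skeleton `σ` -/

section WithSkeleton

variable {K : Type u} [Field K] {V : Type v} [Quiver.{w} V] {L : ℕ}

theorem isPoly_pathMat {d : V → ℕ} {i j : V} (p : Quiver.Path i j) (r : Fin (d j))
    (s : Fin (d i)) : IsPoly fun x : Coord d → K => pathMat x p r s := by
  induction p with
  | nil => exact IsPoly.const _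
  | @cons k l p a ih =>
    simp only [pathMat, Matrix.mul_apply]
    exact IsPoly.sum _ fun t => (IsPoly.coord (ι := Coord d) ⟨k, l, a, r, t⟩).mul (ih t)

variable [Fintype V] {S : Fin (L + 1) → V → ℕ} {σ : Finset (PPath S)}

/-- A module with layering `S` in which `σ` gives a basis is of the form `P / R(σ)_x`. -/
theorem exists_presEquiv (hσ : IsSkeleton σ) {M : Type*} [AddCommGroup M] [Module K M]
    [Module (Lam K V L) M] [IsScalarTower K (Lam K V L) M] [Module.Finite K M]
    (hM : HasLayering K S M) {m : Top S → M} (hm : ∀ r, idem K L r.1 • m r = m r)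
    (b : Module.Basis {u // u ∈ σ} K M) (hb : ∀ u, b u = pathElt K L u.1.path • m u.1.root) :
    ∃ x : Param σ → K, Nonempty (Pres x ≃ₗ[Lam K V L] M) := by
  classical
  let x : Param σ → K := fun qp =>
    b.repr (pathElt K L qp.1.1.path • m qp.1.1.root) ⟨qp.1.2, qp.2.2.1⟩
  refine ⟨x, nonempty_presEquiv hσ x hm (fun q => ?_) b hb⟩
  -- The critical element lies in the radical power given by its length, at its end vertex. By the
  -- layering this space is spanned by the paths of `σ(q)`, so no other coordinates occur.
  have h1 := pathElt_smul_mem (K := K) (L := L) q.1.path (m q.1.root)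
  rw [hM.vertexRad_eq (b := b) (lev := fun u => u.1.path.length) (vert := fun u => u.1.target)
    b.linearIndependent (fun u => hb u ▸ pathElt_smul_mem _ _) hσ.card_eq, levelSpan,
    b.mem_span_image] at h1
  conv_lhs => rw [← b.sum_repr (pathElt K L q.1.path • m q.1.root)]
  rw [← Finset.sum_coe_sort σ fun p => par x q.1 p • pathElt K L p.path • m p.root]
  refine Finset.sum_congr rfl fun p _ => ?_
  rw [hb]
  congr 1
  by_cases hp : InSigma σ q.1 p.1
  · unfold par
    rw [dif_pos ⟨q.2, hp⟩]
  · rw [par_eq_zero hp]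
    by_contra hne
    have h2 := h1 (Finsupp.mem_support_iff.2 hne)
    exact hp ⟨p.2, h2.2, h2.1⟩

/-- Fix the top vectors of the reference module. That the paths of `σ` applied to them form a basis
is a rank condition on a matrix with polynomial entries, and it holds at the reference point. -/
theorem exists_isOpen_presEquiv (hσ : IsSkeleton σ) (x₀ : Param σ → K) :
    ∃ O : Set (RepVar K L (dimVec S)), IsOpen O ∧ skeletonPoint hσ x₀ ∈ O ∧
      ∀ y ∈ O ∩ RepS K S, ∃ x : Param σ → K, Nonempty (Pres x ≃ₗ[Lam K V L] RepModule y) := by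
  classical
  -- The same vectors serve for every `y`, since the underlying space and the action of the vertices
  -- do not depend on `y`.
  let m : Top S → (i : V) → Fin (dimVec S i) → K := fun r =>
    skeletonBasis hσ x₀ ⟨_, hσ.root_mem r⟩
  have hm : ∀ (y : RepVar K L (dimVec S)) (r : Top S),
      idem K L r.1 • (id (m r) : RepModule y) = (id (m r) : RepModule y) := by
    intro y r
    have h := idem_smul_skeletonBasis hσ x₀ ⟨_, hσ.root_mem r⟩
    rw [idem_smul_rep] at h ⊢
    exact h
  let A : (Coord (dimVec S) → K) → Matrix (Σ i, Fin (dimVec S i)) {u // u ∈ σ} K := fun x =>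
    Matrix.of fun s u => (Pi.single u.1.target ((pathMat x u.1.path).mulVec (m u.1.root u.1.root.1)) :
      (i : V) → Fin (dimVec S i) → K) s.1 s.2
  have hA : ∀ s u, IsPoly fun x => A x s u := fun s u => by
    refine isPoly_single (fun r => ?_) s.1 s.2
    simp only [Matrix.mulVec, dotProduct]
    exact IsPoly.sum _ fun k => (isPoly_pathMat _ _ _).mul (IsPoly.const _)
  have hrank : ∀ y : RepVar K L (dimVec S), (A y.1).rank = Module.finrank K
      (Submodule.span K (Set.range fun u : {u // u ∈ σ} =>
        pathElt K L u.1.path • (id (m u.1.root) : RepModule y))) := fun y => by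
    have hcol : (fun u : {u // u ∈ σ} => pathElt K L u.1.path • (id (m u.1.root) : RepModule y)) =
        LinearEquiv.piCurry K (fun i (_ : Fin (dimVec S i)) => K) ∘ (A y.1).col := by
      funext u
      rw [pathElt_smul_rep]
      rfl
    rw [Matrix.rank_eq_finrank_span_cols,
      ← LinearEquiv.finrank_map_eq (LinearEquiv.piCurry K fun i (_ : Fin (dimVec S i)) => K),
      Submodule.map_span, ← Set.range_comp, hcol]
    rfl
  have hcard : Fintype.card {u // u ∈ σ} = ∑ i, dimVec S i := by
    rw [Fintype.card_congr (sigmaEquiv hσ)]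
    simp
  refine ⟨Subtype.val ⁻¹' {x | ∑ i, dimVec S i ≤ (A x).rank}, ?_, ?_, ?_⟩
  · let _ := zariski (Coord (dimVec S)) K
    exact (isOpen_le_rank hA _).preimage continuous_induced_dom
  · change _ ≤ (A (skeletonPoint hσ x₀).1).rank
    rw [hrank]
    have h : (fun u : {u // u ∈ σ} => pathElt K L u.1.path •
        (id (m u.1.root) : RepModule (skeletonPoint hσ x₀))) = skeletonBasis hσ x₀ :=
      funext fun u => pathElt_smul_skeletonBasis hσ x₀ u
    rw [h, (skeletonBasis hσ x₀).span_eq, finrank_top, finrank_repModule]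
  · rintro y ⟨hy, hyS⟩
    change _ ≤ (A y.1).rank at hy
    rw [hrank, ← finrank_repModule (y := y)] at hy
    have htop := Submodule.eq_top_of_finrank_eq
      (le_antisymm (Submodule.finrank_le _) hy)
    have hli := linearIndependent_of_top_le_span_of_card_eq_finrank htop.ge
      (by rw [hcard, finrank_repModule])
    exact exists_presEquiv hσ hyS (hm y) (Module.Basis.mk hli htop.ge)
      fun u => Module.Basis.mk_apply _ _ u

end WithSkeleton

/-! ### The generic dimension of the endomorphism rings -/

section GenericDim

variable {K : Type u} [Field K] {V : Type v} [Quiver.{w} V] [Fintype V] {L : ℕ}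

theorem finrank_end_congr {M N : Type*} [AddCommGroup M] [Module K M]
    [Module (Lam K V L) M] [IsScalarTower K (Lam K V L) M] [AddCommGroup N] [Module K N]
    [Module (Lam K V L) N] [IsScalarTower K (Lam K V L) N] (e : M ≃ₗ[Lam K V L] N) :
    Module.finrank K (Module.End (Lam K V L) M) = Module.finrank K (Module.End (Lam K V L) N) :=
  LinearEquiv.finrank_eq
    { toFun := fun φ => e.toLinearMap ∘ₗ φ ∘ₗ e.symm.toLinearMap
      invFun := fun φ => e.symm.toLinearMap ∘ₗ φ ∘ₗ e.toLinearMap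
      left_inv := fun φ => by ext; simp
      right_inv := fun φ => by ext; simp
      map_add' := fun φ ψ => by ext; simp
      map_smul' := fun c φ => by
        ext m
        exact LinearMap.map_smul_of_tower e.toLinearMap c _ }

variable {S : Fin (L + 1) → V → ℕ} {σ : Finset (PPath S)}

theorem finrank_end_pres (hσ : IsSkeleton σ) (x : Param σ → K) :
    Module.finrank K (Module.End (Lam K V L) (Pres x)) = Module.finrank K (solutions x) :=
  (endEquivSolutions x hσ).finrank_eq

variable [∀ i j : V, Fintype (i ⟶ j)] [Infinite K]

/-- A smaller dimension at `y` would hold on a nonempty relatively open subset. By irreducibility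
this meets the open set of modules `P / R(σ)_x`, where the generic solution dimension is a lower
bound. -/
theorem genericSolutionDim_le_finrank_end (hσ : IsSkeleton σ) {y : RepVar K L (dimVec S)}
    (hy : y ∈ RepS K S) :
    genericSolutionDim σ K ≤ Module.finrank K (Module.End (Lam K V L) (RepModule y)) := by
  by_contra! hlt
  obtain ⟨O, hO, h0, hO'⟩ := exists_isOpen_presEquiv (K := K) hσ 0
  obtain ⟨z, hz, hzO, hz'⟩ := isPreirreducible_repS K S O _ hO
    -- The strict inequality is rephrased as a bound by the predecessor; `hlt` makes the generic
    -- dimension positive.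
    (isOpen_finrank_end_le (genericSolutionDim σ K - 1))
    ⟨_, skeletonPoint_mem hσ 0, h0⟩ ⟨y, hy, by simp only [Set.mem_ofPred_eq]; omega⟩
  obtain ⟨x, ⟨e⟩⟩ := hO' z ⟨hzO, hz⟩
  have h1 := genericSolutionDim_le hσ x
  rw [← finrank_end_pres hσ, finrank_end_congr e] at h1
  simp only [Set.mem_ofPred_eq] at hz'
  omega

theorem exists_finrank_end_eq (hσ : IsSkeleton σ) : ∃ y ∈ RepS K S,
    Module.finrank K (Module.End (Lam K V L) (RepModule y)) = genericSolutionDim σ K := by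
  obtain ⟨x, hx⟩ := exists_finrank_solutions_eq (K := K) hσ
  obtain ⟨e⟩ := nonempty_presEquiv_skeletonPoint hσ x
  exact ⟨_, skeletonPoint_mem hσ x, by rw [← finrank_end_congr e, finrank_end_pres hσ, hx]⟩

/-- The open set where the dimension is at most the generic one meets `Rep 𝕊`, hence is dense by
irreducibility. The reverse inequality passes to the closure, as a strictly smaller dimension is an
open condition. -/
theorem generically_finrank_end (hσ : IsSkeleton σ) :
    Generically (closure (RepS K S)) fun y =>
      Module.finrank K (Module.End (Lam K V L) (RepModule y)) = genericSolutionDim σ K := by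
  have hO := isOpen_finrank_end_le (K := K) (L := L) (d := dimVec S) (genericSolutionDim σ K)
  refine ⟨_, hO, ?_, ?_⟩
  · obtain ⟨y, hy, hy'⟩ := exists_finrank_end_eq (K := K) hσ
    have h1 := subset_closure_inter_of_isPreirreducible_of_isOpen (isPreirreducible_repS K S) hO
      ⟨y, hy, hy'.le⟩
    refine closure_minimal (h1.trans (closure_mono fun z hz => ?_)) isClosed_closure
    exact ⟨hz.2, subset_closure hz.1⟩
  · rintro y ⟨hy, hyS⟩
    refine le_antisymm hy ?_
    by_contra! hlt
    obtain ⟨z, hz, hz'⟩ := mem_closure_iff.1 hyS _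
      (isOpen_finrank_end_le (genericSolutionDim σ K - 1))
      (by simp only [Set.mem_ofPred_eq]; omega)
    have := genericSolutionDim_le_finrank_end hσ hz'
    simp only [Set.mem_ofPred_eq] at hz
    omega

end GenericDim

end TruncPath

end

theorem corollary3p5 {K : Type u} [Field K] [IsAlgClosed K] {V : Type v} [Quiver.{w} V]
    [Fintype V] [∀ i j : V, Fintype (i ⟶ j)] (L : ℕ) (S : Fin (L + 1) → V → ℕ)
    (hS : TruncPath.Realizable K S) :
    IsIrreducible (closure (TruncPath.RepS K S)) ∧
    (∃ σ : Finset (TruncPath.PPath S), TruncPath.IsSkeleton σ) ∧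
    ∀ σ : Finset (TruncPath.PPath S), TruncPath.IsSkeleton σ →
      -- the generic dimension of the endomorphism rings
      TruncPath.Generically (closure (TruncPath.RepS K S)) (fun y =>
        Module.finrank K (Module.End (TruncPath.Lam K V L) (TruncPath.RepModule y)) =
          TruncPath.genericSolutionDim σ K) ∧
      -- the system describes the endomorphisms of `P / R(σ)`, for all values of the parameters
      (∀ x : TruncPath.Param σ → K,
        (LinearIndependent K (fun u : {u // u ∈ σ} => TruncPath.cls x u.1) ∧
          Submodule.span K (Set.range fun u : {u // u ∈ σ} => TruncPath.cls x u.1) = ⊤) ∧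
        (∀ (i j : V) (p : Quiver.Path i j) (u : {u // u ∈ σ}),
          TruncPath.pathElt K L p • TruncPath.cls x u.1 =
            ∑ v : {u // u ∈ σ},
              MvPolynomial.aeval x (TruncPath.pathCoeff σ p u v) • TruncPath.cls x v.1) ∧
        ∃ Φ : Module.End (TruncPath.Lam K V L) (TruncPath.Pres x) ≃ₗ[K]
            TruncPath.solutions x,
          ∀ (φ : Module.End (TruncPath.Lam K V L) (TruncPath.Pres x)) (j : TruncPath.Top S),
            φ (TruncPath.topCls x j) =
              ∑ u : {u // u ∈ σ}, TruncPath.coef (Φ φ).1 j u • TruncPath.cls x u.1) ∧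
      -- algebraically independent parameters realize the generic dimension
      (∀ x : TruncPath.Param σ → K, AlgebraicIndependent (⊥ : Subfield K) x →
        Module.finrank K (TruncPath.solutions x) = TruncPath.genericSolutionDim σ K ∧
        Module.finrank K (Module.End (TruncPath.Lam K V L) (TruncPath.Pres x)) =
          TruncPath.genericSolutionDim σ K) := by
  have : Infinite K := IsAlgClosed.instInfinite
  have hex := hS.exists_isSkeleton
  refine ⟨IsIrreducible.closure ⟨?_, TruncPath.isPreirreducible_repS K S⟩, hex, fun σ hσ =>
    ⟨TruncPath.generically_finrank_end hσ, fun x => ⟨⟨TruncPath.linearIndependent_cls hσ x,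
      TruncPath.span_cls hσ x⟩, fun i j p u => TruncPath.satisfiesRel_topCls.pathElt_smul hσ p u,
      TruncPath.endEquivSolutions x hσ, TruncPath.apply_topCls_eq_sum x hσ⟩, fun x hx => ?_⟩⟩
  -- Nonemptiness of `Rep 𝕊`: for any skeleton, the family of zero parameters already yields a
  -- point.
  · obtain ⟨σ, hσ⟩ := hex
    exact ⟨_, TruncPath.skeletonPoint_mem hσ 0⟩
  · have h := TruncPath.finrank_solutions_eq hσ hx
    exact ⟨h, (TruncPath.finrank_end_pres hσ x).trans h⟩
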